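/- Let $N\ge 1$ and $\theta>0$. Let $\mathfrak h=L^2(\mathbb R^3;\mathbb C)$, let $\Psi\in\mathfrak h^{\otimes N}=L^2((\mathbb R^3)^N;\mathbb C)$ be totally antisymmetric with $\|\Psi\|=1$, and put $\rho=|\Psi\rangle\langle\Psi|$. Let $\varphi_1,\dots,\varphi_N\in\mathfrak h$ be orthonormal and put $$p=\sum_{i=1}^N|\varphi_i\rangle\langle\varphi_i|,\qquad q=\mathbf 1-p,\qquad f_{HF}(x)=p(x;x)=\sum_{i=1}^N|\varphi_i(x)|^2 .$$ (The case of interest is $\Psi=\Psi_t$, the solution of the $N$-body Schrödinger equation with Coulomb interaction, and $p=p_t$, the solution of the time-dependent Hartree–Fock equation started from a Slater determinant, at a fixed time $t$; then $f_{HF}$ is the TDHF density.) For a bounded operator $A$ on $\mathfrak h$ let $d\Gamma(A)=\sum_{j=1}^N A_j$, where $A_j$ acts as $A$ on the $j$-th factor. For $g:\mathbb R\to\mathbb R$ let $\hat g=g(d\Gamma(q))$ (functional calculus), $\tau_kg(y)=g(y-k)$, let $S_g=\mathrm{Tr}[\rho\,\hat g]$ be the degree of evaporation, and, for $g$ increasing,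 let $$\rho^{[-1,1]}=\big((\tau_{-1}g-g)^{1/2}\big)^{\wedge}\,\rho\,\big((g-\tau_1g)^{1/2}\big)^{\wedge}.$$ Let $X_{r,z}$ be multiplication by $1_{\{|x-z|\le r\}}$ on $\mathfrak h$, let $d\mu(r,z)=\frac{dr\,dz}{\pi r^5}$ on $(0,\infty)\times\mathbb R^3$, and let the cancellation term be $$\mathcal A=\int \mathcal A(X_\omega)\,d\mu(\omega),\qquad \mathcal A(X)=2\,\Im\,\mathrm{Tr}\Big[d\Gamma(qXp)\big(d\Gamma(pXp)-\mathrm{Tr}[Xp]\big)\rho^{[-1,1]}\Big].$$ Take $g=g_\theta$, where $g_\theta(x)=N^{1-\theta}x\,1_{[0,N^\theta]}(x)+N\,1_{(N^\theta,\infty)}(x)$. If $\|f_{HF}\|_{5/3}<\infty$, then the integral that defines $\mathcal A$ converges absolutely. Moreover, with $\mathcal A$ read as $0$ if that integral does not converge absolutely, and $\infty\cdot 0=0$ on the right-hand side, $$|\mathcal A|\;\le\;5^{-5/6}\,72\,\pi^{1/3}\,N^{1/6}\,\|f_{HF}\|_{5/3}^{5/6}\,S_{g_\theta};$$ in particular $\mathcal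 A\le 5^{-5/6}\,72\,\pi^{1/3}\,N^{1/6}\,\|f_{HF}\|_{5/3}^{5/6}\,S_{g_\theta}$. -/

import Mathlib

open MeasureTheory

open scoped ENNReal

noncomputable section

/-- The one-particle configuration space `ℝ³` with its Euclidean norm. -/
abbrev E3 : Type := EuclideanSpace ℝ (Fin 3)

/-- The one-particle Hilbert space `𝔥 = L²(ℝ³; ℂ)`. -/
abbrev OneBody : Type := Lp ℂ 2 (volume : Measure E3)

/-- The `N`-particle Hilbert space `𝔥^{⊗N} = L²((ℝ³)^N; ℂ)`. -/
abbrev NBody (N : ℕ) : Type := Lp ℂ 2 (volume : Measure (Fin N → E3))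

/-- The space `L²((ℝ³)^{N-1}; ℂ)` of functions of all the particle positions but the `j`-th. -/
abbrev OtherBody {N : ℕ} (j : Fin N) : Type :=
  Lp ℂ 2 (volume : Measure ({k : Fin N // ¬ k = j} → E3))

/-- `Ψ` is totally antisymmetric, that is, it belongs to the fermionic subspace of `𝔥^{⊗N}`. -/
def IsFermionic {N : ℕ} (Ψ : NBody N) : Prop :=
  ∀ σ : Equiv.Perm (Fin N),
    (fun x : Fin N → E3 => Ψ (fun k => x (σ k))) =ᵐ[volume]
      fun x => ((Equiv.Perm.sign σ : ℤ) : ℂ) * Ψ x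

/-! ### Multiplication by a characteristic function -/

/-- Multiplication by the characteristic function of a measurable set, as a linear map. -/
def indicatorLin {α : Type*} [MeasurableSpace α] (μ : Measure α) (s : Set α)
    (hs : MeasurableSet s) : Lp ℂ 2 μ →ₗ[ℂ] Lp ℂ 2 μ where
  toFun f := ((Lp.memLp f).indicator hs).toLp (s.indicator f)
  map_add' f g := by
    rw [← MemLp.toLp_add]
    apply MemLp.toLp_congr
    filter_upwards [Lp.coeFn_add f g] with x hx
    by_cases h : x ∈ s
    · simpa [h] using hx
    · simp [h]
  map_smul' c f := by
    rw [RingHom.id_apply, ← MemLp.toLp_const_smul]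
    apply MemLp.toLp_congr
    filter_upwards [Lp.coeFn_smul c f] with x hx
    by_cases h : x ∈ s
    · simpa [h] using hx
    · simp [h]

theorem norm_indicatorLin_le {α : Type*} [MeasurableSpace α] (μ : Measure α) (s : Set α)
    (hs : MeasurableSet s) (f : Lp ℂ 2 μ) : ‖indicatorLin μ s hs f‖ ≤ 1 * ‖f‖ := by
  have h : ‖((Lp.memLp f).indicator hs).toLp (s.indicator f)‖ ≤ ‖f‖ := by
    rw [Lp.norm_toLp, Lp.norm_def]
    exact ENNReal.toReal_mono (Lp.eLpNorm_ne_top f) (eLpNorm_indicator_le _)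
  rw [one_mul]
  exact h

/-- Multiplication by the characteristic function of a measurable set, as an operator on `L²`. -/
def indicatorOp {α : Type*} [MeasurableSpace α] (μ : Measure α) (s : Set α)
    (hs : MeasurableSet s) : Lp ℂ 2 μ →L[ℂ] Lp ℂ 2 μ :=
  (indicatorLin μ s hs).mkContinuous 1 (fun f => norm_indicatorLin_le μ s hs f)

/-- `X_{r,z}`, multiplication by `1_{|x - z| ≤ r}` on `𝔥`. -/
def ballOp (r : ℝ) (z : E3) : OneBody →L[ℂ] OneBody :=
  indicatorOp volume (Metric.closedBall z r) Metric.isClosed_closedBall.measurableSet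

/-- `X_{r,z}` acting on the `j`-th factor of `𝔥^{⊗N}`: multiplication by `1_{|x_j - z| ≤ r}`. -/
def ballAt {N : ℕ} (j : Fin N) (r : ℝ) (z : E3) : NBody N →L[ℂ] NBody N :=
  indicatorOp volume ((fun x : Fin N → E3 => x j) ⁻¹' Metric.closedBall z r)
    (measurable_pi_apply j Metric.isClosed_closedBall.measurableSet)

/-! ### The projection onto the span of the orbitals, acting on one factor -/

/-- The splitting `x ↦ (x_j, (x_k)_{k ≠ j})`. -/
def splitAt {N : ℕ} (j : Fin N) : (Fin N → E3) ≃ᵐ E3 × ({k : Fin N // ¬ k = j} → E3) :=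
  (MeasurableEquiv.piEquivPiSubtypeProd (fun _ : Fin N => E3) (fun k => k = j)).trans
    (MeasurableEquiv.prodCongr (MeasurableEquiv.funUnique {k : Fin N // k = j} E3)
      (MeasurableEquiv.refl _))

theorem measurePreserving_splitAt {N : ℕ} (j : Fin N) :
    MeasurePreserving (splitAt j) volume (volume.prod volume) := by
  have h1 : MeasurePreserving
      (MeasurableEquiv.piEquivPiSubtypeProd (fun _ : Fin N => E3) (fun k => k = j))
      volume (volume.prod volume) := by
    convert volume_preserving_piEquivPiSubtypeProd (fun _ : Fin N => E3) (fun k => k = j)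
    · rfl
    · rw [Measure.volume_eq_prod]
      congr!
  have h2 := (volume_preserving_funUnique {k : Fin N // k = j} E3).prod
    (MeasurePreserving.id (volume : Measure ({k : Fin N // ¬ k = j} → E3)))
  have h3 := MeasurePreserving.comp h2 h1
  exact h3

theorem memLp_insertAt {N : ℕ} (j : Fin N) (u : OneBody) (Φ : OtherBody j) :
    MemLp (fun x : Fin N → E3 => u (x j) * Φ (fun k => x k.1)) 2 volume := by
  have h : MemLp (fun y : E3 × ({k : Fin N // ¬ k = j} → E3) => u y.1 * Φ y.2) 2
      (volume.prod volume) := by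
    have hm : AEStronglyMeasurable (fun y : E3 × ({k : Fin N // ¬ k = j} → E3) => u y.1 * Φ y.2)
        (volume.prod volume) :=
      (Lp.memLp u).1.comp_fst.mul (Lp.memLp Φ).1.comp_snd
    rw [memLp_two_iff_integrable_sq_norm hm]
    have := ((memLp_two_iff_integrable_sq_norm (Lp.memLp u).1).1 (Lp.memLp u)).mul_prod
      ((memLp_two_iff_integrable_sq_norm (Lp.memLp Φ).1).1 (Lp.memLp Φ))
    simpa only [norm_mul, mul_pow] using this
  exact h.comp_measurePreserving (measurePreserving_splitAt j)

theorem norm_sq_eq_integral {α : Type*} [MeasurableSpace α] {μ : Measure α} (f : Lp ℂ 2 μ) :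
    ‖f‖ ^ 2 = ∫ x, ‖f x‖ ^ 2 ∂μ := by
  have h := L2.inner_def (𝕜 := ℂ) f f
  simp only [inner_self_eq_norm_sq_to_K] at h
  have h2 : ((‖f‖ ^ 2 : ℝ) : ℂ) = ((∫ x, ‖f x‖ ^ 2 ∂μ : ℝ) : ℂ) := by
    rw [← integral_complex_ofReal]
    simpa using h
  exact_mod_cast h2

/-- `(u, Φ) ↦ u(x_j) Φ((x_k)_{k ≠ j})`, as a linear map in `Φ`. -/
def insertLin {N : ℕ} (j : Fin N) (u : OneBody) : OtherBody j →ₗ[ℂ] NBody N where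
  toFun Φ := (memLp_insertAt j u Φ).toLp
  map_add' Φ Φ' := by
    rw [← MemLp.toLp_add]
    apply MemLp.toLp_congr
    have h := (Measure.quasiMeasurePreserving_snd.comp
      (measurePreserving_splitAt j).quasiMeasurePreserving).ae_eq_comp (Lp.coeFn_add Φ Φ')
    filter_upwards [h] with x hx
    have hx' : (Φ + Φ') (fun k => x k.1) = Φ (fun k => x k.1) + Φ' (fun k => x k.1) := hx
    change u (x j) * (Φ + Φ') (fun k => x k.1) =
      u (x j) * Φ (fun k => x k.1) + u (x j) * Φ' (fun k => x k.1)
    rw [hx', mul_add]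
  map_smul' c Φ := by
    rw [RingHom.id_apply, ← MemLp.toLp_const_smul]
    apply MemLp.toLp_congr
    have h := (Measure.quasiMeasurePreserving_snd.comp
      (measurePreserving_splitAt j).quasiMeasurePreserving).ae_eq_comp (Lp.coeFn_smul c Φ)
    filter_upwards [h] with x hx
    have hx' : (c • Φ) (fun k => x k.1) = c * Φ (fun k => x k.1) := hx
    change u (x j) * (c • Φ) (fun k => x k.1) = c * (u (x j) * Φ (fun k => x k.1))
    rw [hx', mul_left_comm]

theorem norm_insertLin {N : ℕ} (j : Fin N) (u : OneBody) (Φ : OtherBody j) :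
    ‖insertLin j u Φ‖ = ‖u‖ * ‖Φ‖ := by
  rw [← sq_eq_sq₀ (norm_nonneg _) (by positivity), mul_pow, norm_sq_eq_integral,
    norm_sq_eq_integral, norm_sq_eq_integral,
    ← integral_prod_mul (fun a => ‖u a‖ ^ 2) (fun b => ‖Φ b‖ ^ 2),
    ← (measurePreserving_splitAt j).integral_comp']
  apply integral_congr_ae
  filter_upwards [MemLp.coeFn_toLp (memLp_insertAt j u Φ)] with x hx
  change ‖((memLp_insertAt j u Φ).toLp : (Fin N → E3) → ℂ) x‖ ^ 2 = _
  rw [hx, norm_mul, mul_pow]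
  rfl

/-- Insertion of a particle with wave function `u` at the `j`-th place:
`(insertAt j u Φ)(x) = u(x_j) Φ((x_k)_{k ≠ j})`. Its adjoint integrates `x_j` against `u`. -/
def insertAt {N : ℕ} (j : Fin N) (u : OneBody) : OtherBody j →L[ℂ] NBody N :=
  (insertLin j u).mkContinuous ‖u‖ (fun Φ => (norm_insertLin j u Φ).le)

/-- `p = ∑ i, |φ_i⟩⟨φ_i|` on `𝔥`. -/
def hfProj {N : ℕ} (φ : Fin N → OneBody) : OneBody →L[ℂ] OneBody :=
  ∑ i, InnerProductSpace.rankOne ℂ (φ i) (φ i)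

/-- `p` acting on the `j`-th factor of `𝔥^{⊗N}`:
`(p_j Ψ)(x) = ∑ i, φ_i(x_j) ∫ conj (φ_i(y)) Ψ(x_1, …, x_{j-1}, y, x_{j+1}, …, x_N) dy`. -/
def projAt {N : ℕ} (φ : Fin N → OneBody) (j : Fin N) : NBody N →L[ℂ] NBody N :=
  ∑ i, insertAt j (φ i) ∘L (insertAt j (φ i)).adjoint

/-- `q = 1 - p` acting on the `j`-th factor of `𝔥^{⊗N}`. -/
def coprojAt {N : ℕ} (φ : Fin N → OneBody) (j : Fin N) : NBody N →L[ℂ] NBody N :=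
  1 - projAt φ j

/-! ### Second quantization, traces, and the functional calculus -/

/-- `dΓ(A) = ∑ j, A_j`, where `A_j` is `A` acting on the `j`-th factor of `𝔥^{⊗N}`. -/
def dGamma {N : ℕ} (A : Fin N → (NBody N →L[ℂ] NBody N)) : NBody N →L[ℂ] NBody N :=
  ∑ j, A j

/-- The trace of an operator, computed in an orthonormal basis. -/
def opTrace {H : Type*} [NormedAddCommGroup H] [InnerProductSpace ℂ H] [CompleteSpace H]
    (T : H →L[ℂ] H) : ℂ :=
  ∑' i, inner ℂ ((exists_hilbertBasis ℂ H).choose_spec.choose i)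
    (T ((exists_hilbertBasis ℂ H).choose_spec.choose i))

/-- The functional calculus `g(T)` of a bounded self-adjoint operator `T` on a Hilbert space. -/
def functionalCalculus {H : Type*} [NormedAddCommGroup H] [InnerProductSpace ℂ H]
    [CompleteSpace H] (g : ℝ → ℝ) (T : H →L[ℂ] H) : H →L[ℂ] H :=
  cfc g T

/-- `ĝ = g(dΓ(q))`, by the functional calculus of self-adjoint operators. -/
def hat {N : ℕ} (φ : Fin N → OneBody) (g : ℝ → ℝ) : NBody N →L[ℂ] NBody N :=
  functionalCalculus g (dGamma (coprojAt φ))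

/-- The density matrix `ρ = |Ψ⟩⟨Ψ|`. -/
def pureState {N : ℕ} (Ψ : NBody N) : NBody N →L[ℂ] NBody N :=
  InnerProductSpace.rankOne ℂ Ψ Ψ

/-- The translate `τ_k g`, `τ_k g(y) = g(y - k)`. -/
def shiftBy (k : ℤ) (g : ℝ → ℝ) : ℝ → ℝ := fun y => g (y - k)

/-- The degree of evaporation `S_g(ρ, p) = Tr[ρ ĝ]` of `ρ = |Ψ⟩⟨Ψ|` relative to `p`. -/
def evaporation {N : ℕ} (φ : Fin N → OneBody) (g : ℝ → ℝ) (Ψ : NBody N) : ℝ :=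
  (opTrace (pureState Ψ * hat φ g)).re

/-- `ρ^{[-j,j]} = ((τ_{-j} g - g)^{1/2})^ ρ ((g - τ_j g)^{1/2})^`. -/
def rhoShift {N : ℕ} (φ : Fin N → OneBody) (g : ℝ → ℝ) (Ψ : NBody N) (j : ℤ) :
    NBody N →L[ℂ] NBody N :=
  hat φ (fun y => Real.sqrt (shiftBy (-j) g y - g y)) * pureState Ψ *
    hat φ (fun y => Real.sqrt (g y - shiftBy j g y))

/-- `g_θ(x) = N^{1-θ} x` on `[0, N^θ]`, `g_θ(x) = N` for `x > N^θ`, and `g_θ(x) = 0` for `x < 0`. -/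
def gTheta (N : ℕ) (θ : ℝ) (x : ℝ) : ℝ :=
  (N : ℝ) ^ (1 - θ) * x * (Set.Icc 0 ((N : ℝ) ^ θ)).indicator 1 x +
    N * (Set.Ioi ((N : ℝ) ^ θ)).indicator 1 x

/-! ### The cancellation term -/

/-- `𝒜(X) = 2 Im Tr[dΓ(q X p) (dΓ(p X p) - Tr[X p]) ρ^{[-1,1]}]` for `X = X_{r,z}`. -/
def cancellationIntegrand {N : ℕ} (φ : Fin N → OneBody) (g : ℝ → ℝ) (Ψ : NBody N)
    (ω : ℝ × E3) : ℝ :=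
  2 * (opTrace
    (dGamma (fun j => coprojAt φ j * ballAt j ω.1 ω.2 * projAt φ j) *
      (dGamma (fun j => projAt φ j * ballAt j ω.1 ω.2 * projAt φ j) -
        opTrace (ballOp ω.1 ω.2 * hfProj φ) • (1 : NBody N →L[ℂ] NBody N)) *
      rhoShift φ g Ψ 1)).im

/-- The Fefferman–de la Llave measure `dμ(r, z) = (π r⁵)⁻¹ dr dz` on `(0, ∞) × ℝ³`. -/
def feffermanMeasure : Measure (ℝ × E3) :=
  ((volume.restrict (Set.Ioi (0 : ℝ))).withDensity
    (fun r => ENNReal.ofReal (1 / (Real.pi * r ^ 5)))).prod volume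

/-- The cancellation term `𝒜 = ∫ 𝒜(X_ω) dμ(ω)`. -/
def cancellationTerm {N : ℕ} (φ : Fin N → OneBody) (g : ℝ → ℝ) (Ψ : NBody N) : ℝ :=
  ∫ ω, cancellationIntegrand φ g Ψ ω ∂feffermanMeasure

/-- The one-particle density `f_HF(x) = p(x; x) = ∑ i, |φ_i(x)|²`. -/
def hfDensity {N : ℕ} (φ : Fin N → OneBody) (x : E3) : ℝ :=
  ∑ i, ‖φ i x‖ ^ 2

end

noncomputable section

/-! ### Product states -/

/-! Since `rhoShift` is the rank-one operator |χ⟩⟨Φ| with χ = (τ₋₁g − g)^{1/2}^ Ψ and Φ = (g −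
τ₁g)^{1/2}^ Ψ, the integrand is, up to sign, 2 Im ⟨Φ, dΓ(qXp) D χ⟩ with D = Tr[Xp] − dΓ(pXp). The
gain comes from D being small where few particles have evaporated.

Pointwise bound. By the Pauli principle 0 ≤ D ≤ τ := Tr[Xp] on antisymmetric states
(`IsFermionic.sum_norm_ballAt_projAt_sq_le`), hence D² ≤ τD. Cauchy–Schwarz over the particles then
bounds the integrand by τ(a + b), where a is the expectation of dΓ(qXq) in Φ and b that of D in χ
(`IsFermionic.norm_inner_dGamma_holeOp_le`).

Integration over centres. The integral of X_{r,z} over z is |B_r| times the identity, so a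
integrates to |B_r|⟨dΓ(q)⟩_Φ. Because N − dΓ(p) = dΓ(q), b integrates to |B_r|⟨dΓ(q)⟩_χ
(`IsFermionic.lintegral_holeBall`). Both expectations are at most S_g: for y ≥ 0 the products of y
with g(y) − g(y−1) and with g(y+1) − g(y) are at most g(y), because g is nonnegative and
nondecreasing and g(y)/y is nonincreasing for y > 0 (`mul_gTheta_le`).

Integration over radii. Hölder's inequality and the bound p ≤ 1 on X-expectations give τ ≤
min(‖f_HF‖_{5/3}|B_r|^{2/5}, N). Against |B_r| dr/(πr⁵) the first bound is integrable at 0 and the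
second at infinity; splitting where they agree gives N^{1/6}‖f_HF‖_{5/3}^{5/6} with the constant
8(4π/3)^{1/3} (`lintegral_radial_le`). The two expectations double it, and the result lies below the
stated constant. -/

theorem memLp_prod_apply {ι : Type*} [Fintype ι] (f : ι → OneBody) :
    MemLp (fun x : ι → E3 => ∏ i, f i (x i)) 2 volume := by
  have hm : AEStronglyMeasurable (fun x : ι → E3 => ∏ i, f i (x i)) volume :=
    Finset.aestronglyMeasurable_fun_prod _ fun i _ =>
      (Lp.memLp (f i)).1.comp_quasiMeasurePreserving (Measure.quasiMeasurePreserving_eval _ i)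
  rw [memLp_two_iff_integrable_sq_norm hm]
  have := Integrable.fintype_prod (μ := fun _ : ι => (volume : Measure E3))
    (f := fun i x => ‖f i x‖ ^ 2)
    fun i => (memLp_two_iff_integrable_sq_norm (Lp.memLp (f i)).1).1 (Lp.memLp (f i))
  simp only [norm_prod, ← Finset.prod_pow]
  exact this

/-- The product state `x ↦ ∏ i, f_i(x_i)`. -/
def productState {ι : Type*} [Fintype ι] (f : ι → OneBody) :
    Lp ℂ 2 (volume : Measure (ι → E3)) :=
  (memLp_prod_apply f).toLp

theorem coeFn_productState {ι : Type*} [Fintype ι] (f : ι → OneBody) :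
    productState f =ᵐ[volume] fun x => ∏ i, f i (x i) :=
  MemLp.coeFn_toLp _

theorem quasiMeasurePreserving_eval {ι : Type*} [Fintype ι] (j : ι) :
    Measure.QuasiMeasurePreserving (fun x : ι → E3 => x j) volume volume :=
  Measure.quasiMeasurePreserving_eval (fun _ : ι => (volume : Measure E3)) j

theorem quasiMeasurePreserving_restrict_ne {N : ℕ} (j : Fin N) :
    Measure.QuasiMeasurePreserving
      (fun (x : Fin N → E3) (k : {k : Fin N // ¬ k = j}) => x k.1) volume volume :=
  Measure.quasiMeasurePreserving_snd.comp (measurePreserving_splitAt j).quasiMeasurePreserving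

theorem coeFn_insertAt {N : ℕ} (j : Fin N) (u : OneBody) (Φ : OtherBody j) :
    insertAt j u Φ =ᵐ[volume] fun x => u (x j) * Φ (fun k => x k.1) :=
  MemLp.coeFn_toLp (memLp_insertAt j u Φ)

theorem insertAt_add {N : ℕ} (j : Fin N) (u v : OneBody) :
    insertAt j (u + v) = insertAt j u + insertAt j v := by
  ext1 Φ
  refine Lp.ext ?_
  filter_upwards [coeFn_insertAt j u Φ, coeFn_insertAt j v Φ, coeFn_insertAt j (u + v) Φ,
    Lp.coeFn_add (insertAt j u Φ) (insertAt j v Φ),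
    (quasiMeasurePreserving_eval j).ae_eq_comp (Lp.coeFn_add u v)] with x h1 h2 h3 h4 h5
  have h5' : (u + v) (x j) = u (x j) + v (x j) := h5
  rw [h3, h5', add_mul, add_apply, h4, Pi.add_apply, h1, h2]

theorem insertAt_smul {N : ℕ} (j : Fin N) (c : ℂ) (u : OneBody) :
    insertAt j (c • u) = c • insertAt j u := by
  ext1 Φ
  refine Lp.ext ?_
  filter_upwards [coeFn_insertAt j u Φ, coeFn_insertAt j (c • u) Φ,
    Lp.coeFn_smul c (insertAt j u Φ),
    (quasiMeasurePreserving_eval j).ae_eq_comp (Lp.coeFn_smul c u)] with x h1 h3 h4 h5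
  have h5' : (c • u) (x j) = c * u (x j) := h5
  rw [h3, h5', smul_apply, h4, Pi.smul_apply, h1, smul_eq_mul, mul_assoc]

theorem insertAt_sum_smul {N : ℕ} {κ : Type*} (s : Finset κ) (j : Fin N) (c : κ → ℂ)
    (u : κ → OneBody) :
    insertAt j (∑ i ∈ s, c i • u i) = ∑ i ∈ s, c i • insertAt j (u i) := by
  classical
  induction s using Finset.induction_on with
  | empty =>
    have := insertAt_smul j 0 (0 : OneBody)
    simpa using this
  | insert a s ha ih => rw [Finset.sum_insert ha, Finset.sum_insert ha, insertAt_add,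
      insertAt_smul, ih]

/-- Fubini along `splitAt j`: the integrand factors into a function of `x j` and a function of the
other positions. -/
theorem inner_insertAt {N : ℕ} (j : Fin N) (u v : OneBody) (Φ Φ' : OtherBody j) :
    inner ℂ (insertAt j u Φ) (insertAt j v Φ') = inner ℂ u v * inner ℂ Φ Φ' := by
  rw [L2.inner_def, L2.inner_def, L2.inner_def,
    ← integral_prod_mul (fun a => inner ℂ (u a) (v a)) (fun b => inner ℂ (Φ b) (Φ' b)),
    ← (measurePreserving_splitAt j).integral_comp']
  apply integral_congr_ae
  filter_upwards [coeFn_insertAt j u Φ, coeFn_insertAt j v Φ'] with x h1 h2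
  rw [h1, h2]
  change _ = inner ℂ (u (x j)) (v (x j)) * inner ℂ (Φ (fun k => x k.1)) (Φ' (fun k => x k.1))
  simp only [RCLike.inner_apply, map_mul]
  ring

theorem adjoint_insertAt_insertAt {N : ℕ} (j : Fin N) (u v : OneBody) (Φ : OtherBody j) :
    (insertAt j u).adjoint (insertAt j v Φ) = inner ℂ u v • Φ := by
  refine ext_inner_left ℂ fun Θ => ?_
  rw [ContinuousLinearMap.adjoint_inner_right, inner_insertAt, inner_smul_right]

theorem insertAt_productState {N : ℕ} (j : Fin N) (u : OneBody) (f : Fin N → OneBody) :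
    insertAt j u (productState fun k : {k : Fin N // ¬ k = j} => f k.1) =
      productState (Function.update f j u) := by
  refine Lp.ext ?_
  filter_upwards [coeFn_insertAt j u (productState fun k : {k : Fin N // ¬ k = j} => f k.1),
    coeFn_productState (Function.update f j u),
    (quasiMeasurePreserving_restrict_ne j).ae_eq_comp
      (coeFn_productState fun k : {k : Fin N // ¬ k = j} => f k.1)] with x h1 h2 h3
  have h3' : (productState fun k : {k : Fin N // ¬ k = j} => f k.1) (fun k => x k.1) =
    ∏ k : {k : Fin N // ¬ k = j}, f k.1 (x k.1) := h3
  rw [h1, h2, h3', Fintype.prod_eq_mul_prod_subtype_ne _ j, Function.update_self]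
  congr 1
  refine Finset.prod_congr rfl fun k _ => ?_
  rw [Function.update_of_ne k.2]

theorem adjoint_insertAt_productState {N : ℕ} (j : Fin N) (u : OneBody) (f : Fin N → OneBody) :
    (insertAt j u).adjoint (productState f) =
      inner ℂ u (f j) • productState fun k : {k : Fin N // ¬ k = j} => f k.1 := by
  rw [← adjoint_insertAt_insertAt, insertAt_productState, Function.update_eq_self]

/-- An `L²` function that is orthogonal to all product states vanishes. -/
theorem eq_zero_of_inner_productState_eq_zero {ι : Type*} [Fintype ι]
    (Φ : Lp ℂ 2 (volume : Measure (ι → E3))) (h : ∀ f, inner ℂ (productState f) Φ = 0) :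
    Φ = 0 := by
  -- On bounded boxes Φ is integrable and indicators are square integrable, so Φ can be tested
  -- against products of indicators.
  set B : ℕ → Set (ι → E3) := fun n => Set.univ.pi fun _ => Metric.closedBall 0 n with hB
  have hBm : ∀ n, MeasurableSet (B n) := fun n =>
    MeasurableSet.univ_pi fun _ => Metric.isClosed_closedBall.measurableSet
  have hfin : ∀ n, volume (B n) < ⊤ := fun n => by
    rw [hB, volume_pi_pi]
    exact ENNReal.prod_lt_top fun i _ => measure_closedBall_lt_top
  have hrect : ∀ (n : ℕ) (s : ι → Set E3), (∀ i, MeasurableSet (s i)) →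
      ∫ x in Set.univ.pi s ∩ B n, Φ x = 0 := by
    intro n s hs
    have hs' : ∀ i, MeasurableSet (s i ∩ Metric.closedBall 0 n) := fun i =>
      (hs i).inter Metric.isClosed_closedBall.measurableSet
    have hsf : ∀ i, volume (s i ∩ Metric.closedBall 0 n) ≠ ⊤ := fun i =>
      ((measure_mono Set.inter_subset_right).trans_lt measure_closedBall_lt_top).ne
    have h0 := h fun i => indicatorConstLp 2 (hs' i) (hsf i) (1 : ℂ)
    rw [L2.inner_def] at h0
    rw [← integral_indicator ((MeasurableSet.univ_pi hs).inter (hBm n)), ← h0]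
    apply integral_congr_ae
    have hae : ∀ᵐ x : ι → E3, ∀ i, indicatorConstLp 2 (hs' i) (hsf i) (1 : ℂ) (x i) =
        (s i ∩ Metric.closedBall 0 n).indicator (fun _ => (1 : ℂ)) (x i) :=
      ae_all_iff.2 fun i =>
        (quasiMeasurePreserving_eval i).ae_eq_comp
          (indicatorConstLp_coeFn (p := 2) (hs := hs' i) (hμs := hsf i) (c := (1 : ℂ)))
    filter_upwards [coeFn_productState fun i => indicatorConstLp 2 (hs' i) (hsf i) (1 : ℂ),
      hae] with x h1 h2
    rw [h1, Finset.prod_congr rfl fun i _ => h2 i]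
    by_cases hx : x ∈ Set.univ.pi s ∩ B n
    · have : ∀ i, x i ∈ s i ∩ Metric.closedBall 0 n := fun i => ⟨hx.1 i trivial, hx.2 i trivial⟩
      rw [Set.indicator_of_mem hx, Finset.prod_eq_one]
      · simp
      · intro i _
        rw [Set.indicator_of_mem (this i)]
    · have : ∃ i, x i ∉ s i ∩ Metric.closedBall 0 n := by
        by_contra! hc
        exact hx ⟨fun i _ => (hc i).1, fun i _ => (hc i).2⟩
      obtain ⟨i, hi⟩ := this
      rw [Set.indicator_of_notMem hx, Finset.prod_eq_zero (Finset.mem_univ i)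
        (Set.indicator_of_notMem hi _)]
      simp
  have hint : ∀ n, IntegrableOn Φ (B n) := fun n => by
    have : IsFiniteMeasure (volume.restrict (B n)) := ⟨by
      rw [Measure.restrict_apply_univ]
      exact hfin n⟩
    exact ((Lp.memLp Φ).restrict (B n)).integrable one_le_two
  have hset : ∀ (n : ℕ) (A : Set (ι → E3)), MeasurableSet A → ∫ x in A ∩ B n, Φ x = 0 := by
    intro n A hA
    -- Rectangles form a π-system generating the product σ-algebra, so vanishing integrals pass from
    -- rectangles to all measurable subsets of the box.
    refine MeasurableSpace.induction_on_inter (C := fun A _ => ∫ x in A ∩ B n, Φ x = 0)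
      generateFrom_pi.symm isPiSystem_pi (by simp) ?_ ?_ ?_ A hA
    · rintro _ ⟨s, hs, rfl⟩
      exact hrect n s fun i => hs i trivial
    · intro t ht ih
      have h1 := hrect n (fun _ => Set.univ) fun _ => MeasurableSet.univ
      rw [Set.pi_univ, Set.univ_inter] at h1
      have h2 := integral_inter_add_sdiff (s := B n) ht (hint n)
      rw [Set.inter_comm, ih, zero_add, h1] at h2
      rwa [Set.inter_comm, ← Set.sdiff_eq]
    · intro t hd ht ih
      rw [Set.iUnion_inter, integral_iUnion (fun i => (ht i).inter (hBm n))
        (fun i j hij => (hd hij).mono Set.inter_subset_left Set.inter_subset_left)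
        ((hint n).mono_set (Set.iUnion_subset fun i => Set.inter_subset_right))]
      simp [ih]
  have hz : ∀ n, ∀ᵐ x ∂volume.restrict (B n), Φ x = 0 := fun n =>
    Integrable.ae_eq_zero_of_forall_setIntegral_eq_zero (hint n) fun s hs _ => by
      rw [Measure.restrict_restrict hs]
      exact hset n s hs
  have hU : ⋃ n, B n = Set.univ := by
    refine Set.eq_univ_of_forall fun x => ?_
    obtain ⟨n, hn⟩ := exists_nat_ge (∑ i, ‖x i‖)
    refine Set.mem_iUnion.2 ⟨n, fun i _ => ?_⟩
    rw [mem_closedBall_zero_iff]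
    exact (Finset.single_le_sum (f := fun i => ‖x i‖) (fun _ _ => norm_nonneg _)
      (Finset.mem_univ i)).trans hn
  have hz' : ∀ᵐ x ∂volume.restrict (⋃ n, B n), Φ x = 0 :=
    (ae_restrict_iUnion_iff B _).2 hz
  rw [hU, Measure.restrict_univ] at hz'
  exact (Lp.eq_zero_iff_ae_eq_zero).2 hz'

theorem dense_span_productState {ι : Type*} [Fintype ι] :
    Dense (Submodule.span ℂ (Set.range (productState (ι := ι))) :
      Set (Lp ℂ 2 (volume : Measure (ι → E3)))) := by
  rw [Submodule.dense_iff_topologicalClosure_eq_top, Submodule.topologicalClosure_eq_top_iff,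
    Submodule.eq_bot_iff]
  intro Φ hΦ
  refine eq_zero_of_inner_productState_eq_zero Φ fun f => ?_
  exact (Submodule.mem_orthogonal _ Φ).1 hΦ _ (Submodule.subset_span ⟨f, rfl⟩)

/-- Two operators that agree on product states are equal. -/
theorem ext_productState {ι : Type*} [Fintype ι] {G : Type*} [NormedAddCommGroup G]
    [NormedSpace ℂ G] {A B : Lp ℂ 2 (volume : Measure (ι → E3)) →L[ℂ] G}
    (h : ∀ f, A (productState f) = B (productState f)) : A = B :=
  ContinuousLinearMap.ext_on dense_span_productState (by rintro _ ⟨f, rfl⟩; exact h f)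

/-! ### Permutations of the particles -/

theorem measurePreserving_comp_perm {ι : Type*} [Fintype ι] (σ : Equiv.Perm ι) :
    MeasurePreserving (fun (x : ι → E3) k => x (σ k)) volume volume := by
  have h := volume_measurePreserving_piCongrLeft (fun _ : ι => E3) σ.symm
  convert h using 1
  ext x k : 2
  exact ((MeasurableEquiv.piCongrLeft_apply_apply (β := fun _ : ι => E3) σ.symm x (σ k)).symm.trans
    (by rw [Equiv.symm_apply_apply])).trans rfl

/-- The unitary `(U_σ Ψ)(x) = Ψ((x_{σ k})_k)`. -/
def permOp {N : ℕ} (σ : Equiv.Perm (Fin N)) : NBody N →L[ℂ] NBody N :=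
  (Lp.compMeasurePreservingₗᵢ ℂ _ (measurePreserving_comp_perm σ)).toContinuousLinearMap

theorem coeFn_permOp {N : ℕ} (σ : Equiv.Perm (Fin N)) (Ψ : NBody N) :
    permOp σ Ψ =ᵐ[volume] fun x => Ψ (fun k => x (σ k)) :=
  Lp.coeFn_compMeasurePreserving Ψ (measurePreserving_comp_perm σ)

theorem isFermionic_iff {N : ℕ} (Ψ : NBody N) :
    IsFermionic Ψ ↔ ∀ σ : Equiv.Perm (Fin N), permOp σ Ψ = ((Equiv.Perm.sign σ : ℤ) : ℂ) • Ψ := by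
  refine forall_congr' fun σ => ⟨fun h => Lp.ext ?_, fun h => ?_⟩
  · filter_upwards [h, coeFn_permOp σ Ψ,
      Lp.coeFn_smul ((Equiv.Perm.sign σ : ℤ) : ℂ) Ψ] with x h1 h2 h3
    rw [h2, h3, h1, Pi.smul_apply, smul_eq_mul]
  · filter_upwards [coeFn_permOp σ Ψ,
      Lp.coeFn_smul ((Equiv.Perm.sign σ : ℤ) : ℂ) Ψ] with x h2 h3
    rw [← h2, h, h3, Pi.smul_apply, smul_eq_mul]

/-- This keeps the vectors ĝΨ, Dχ and χ − tDχ antisymmetric, so that the Pauli bounds can be applied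
to them as well as to Ψ. -/
theorem IsFermionic.map {N : ℕ} {Ψ : NBody N} (hΨ : IsFermionic Ψ) {A : NBody N →L[ℂ] NBody N}
    (hA : ∀ σ, permOp σ * A = A * permOp σ) : IsFermionic (A Ψ) := by
  rw [isFermionic_iff] at hΨ ⊢
  intro σ
  have := congrArg (fun B => B Ψ) (hA σ)
  simp only [mul_apply_eq_comp] at this
  rw [this, hΨ σ, map_smul]

theorem permOp_productState {N : ℕ} (σ : Equiv.Perm (Fin N)) (f : Fin N → OneBody) :
    permOp σ (productState f) = productState (f ∘ σ.symm) := by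
  refine Lp.ext ?_
  filter_upwards [coeFn_permOp σ (productState f), coeFn_productState (f ∘ σ.symm),
    (measurePreserving_comp_perm σ).quasiMeasurePreserving.ae_eq_comp
      (coeFn_productState f)] with x h1 h2 h3
  have h3' : (productState f) (fun k => x (σ k)) = ∏ k, f k (x (σ k)) := h3
  rw [h1, h2, h3', ← Equiv.prod_comp σ (fun k => (f ∘ σ.symm) k (x k))]
  simp

theorem insertAt_adjoint_productState {N : ℕ} (j : Fin N) (u v : OneBody) (f : Fin N → OneBody) :
    insertAt j u ((insertAt j v).adjoint (productState f)) =
      inner ℂ v (f j) • productState (Function.update f j u) := by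
  rw [adjoint_insertAt_productState, map_smul, insertAt_productState]

/-- Checked on product states, where |u⟩⟨v| at place j only replaces one factor and U_σ only
relabels the factors. -/
theorem permOp_insertAt_adjoint {N : ℕ} (σ : Equiv.Perm (Fin N)) (j : Fin N) (u v : OneBody) :
    permOp σ * (insertAt j u ∘L (insertAt j v).adjoint) =
      (insertAt (σ j) u ∘L (insertAt (σ j) v).adjoint) * permOp σ := by
  refine ext_productState fun f => ?_
  simp only [mul_apply_eq_comp, ContinuousLinearMap.comp_apply,
    insertAt_adjoint_productState, map_smul, permOp_productState, Function.comp_apply,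
    Equiv.symm_apply_apply, Function.update_comp_equiv, Equiv.symm_symm]

theorem permOp_projAt {N : ℕ} (φ : Fin N → OneBody) (σ : Equiv.Perm (Fin N)) (j : Fin N) :
    permOp σ * projAt φ j = projAt φ (σ j) * permOp σ := by
  rw [projAt, projAt, Finset.mul_sum, Finset.sum_mul]
  exact Finset.sum_congr rfl fun i _ => permOp_insertAt_adjoint σ j _ _

theorem permOp_coprojAt {N : ℕ} (φ : Fin N → OneBody) (σ : Equiv.Perm (Fin N)) (j : Fin N) :
    permOp σ * coprojAt φ j = coprojAt φ (σ j) * permOp σ := by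
  rw [coprojAt, coprojAt, mul_sub, sub_mul, permOp_projAt, mul_one, one_mul]

theorem coeFn_indicatorOp {α : Type*} [MeasurableSpace α] (μ : Measure α) (s : Set α)
    (hs : MeasurableSet s) (f : Lp ℂ 2 μ) : indicatorOp μ s hs f =ᵐ[μ] s.indicator f := by
  have h : MemLp (s.indicator f) 2 μ := (Lp.memLp f).indicator hs
  exact h.coeFn_toLp

theorem ballAt_insertAt {N : ℕ} (j : Fin N) (r : ℝ) (z : E3) (u : OneBody) (Φ : OtherBody j) :
    ballAt j r z (insertAt j u Φ) = insertAt j (ballOp r z u) Φ := by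
  refine Lp.ext ?_
  filter_upwards [coeFn_insertAt j u Φ, coeFn_insertAt j (ballOp r z u) Φ,
    coeFn_indicatorOp volume ((fun x : Fin N → E3 => x j) ⁻¹' Metric.closedBall z r)
      (measurable_pi_apply j Metric.isClosed_closedBall.measurableSet) (insertAt j u Φ),
    (quasiMeasurePreserving_eval j).ae_eq_comp (coeFn_indicatorOp volume (Metric.closedBall z r)
      Metric.isClosed_closedBall.measurableSet u)] with x h1 h2 h3 h4
  have h4' : (ballOp r z u) (x j) = (Metric.closedBall z r).indicator u (x j) := h4
  rw [ballAt, h3, h2, h4']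
  by_cases hx : x j ∈ Metric.closedBall z r
  · rw [Set.indicator_of_mem hx, Set.indicator_of_mem (by exact hx), h1]
  · rw [Set.indicator_of_notMem hx, Set.indicator_of_notMem (by exact hx), zero_mul]

theorem ballAt_productState {N : ℕ} (j : Fin N) (r : ℝ) (z : E3) (f : Fin N → OneBody) :
    ballAt j r z (productState f) = productState (Function.update f j (ballOp r z (f j))) := by
  rw [← insertAt_productState, ← ballAt_insertAt, insertAt_productState, Function.update_eq_self]

theorem permOp_ballAt {N : ℕ} (σ : Equiv.Perm (Fin N)) (j : Fin N) (r : ℝ) (z : E3) :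
    permOp σ * ballAt j r z = ballAt (σ j) r z * permOp σ := by
  refine ext_productState fun f => ?_
  simp only [mul_apply_eq_comp, ballAt_productState, permOp_productState,
    Function.comp_apply, Equiv.symm_apply_apply, Function.update_comp_equiv, Equiv.symm_symm]

theorem permOp_dGamma {N : ℕ} {A : Fin N → (NBody N →L[ℂ] NBody N)} (σ : Equiv.Perm (Fin N))
    (hA : ∀ j, permOp σ * A j = A (σ j) * permOp σ) :
    permOp σ * dGamma A = dGamma A * permOp σ := by
  rw [dGamma, Finset.mul_sum, Finset.sum_mul, ← Equiv.sum_comp σ (fun j => A j * permOp σ)]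
  exact Finset.sum_congr rfl fun j _ => hA j

theorem permOp_dGamma_coprojAt {N : ℕ} (φ : Fin N → OneBody) (σ : Equiv.Perm (Fin N)) :
    permOp σ * dGamma (coprojAt φ) = dGamma (coprojAt φ) * permOp σ :=
  permOp_dGamma σ (permOp_coprojAt φ σ)

theorem permOp_dGamma_proj_ball_proj {N : ℕ} (φ : Fin N → OneBody) (r : ℝ) (z : E3)
    (σ : Equiv.Perm (Fin N)) :
    permOp σ * dGamma (fun j => projAt φ j * ballAt j r z * projAt φ j) =
      dGamma (fun j => projAt φ j * ballAt j r z * projAt φ j) * permOp σ := by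
  refine permOp_dGamma σ fun j => ?_
  rw [← mul_assoc, ← mul_assoc, permOp_projAt, mul_assoc _ (permOp σ), permOp_ballAt,
    ← mul_assoc, mul_assoc _ (permOp σ), permOp_projAt]
  simp only [mul_assoc]

theorem ofReal_norm_sq_eq_inner {H : Type*} [NormedAddCommGroup H] [InnerProductSpace ℂ H]
    (v : H) : ((‖v‖ ^ 2 : ℝ) : ℂ) = inner ℂ v v := by
  rw [inner_self_eq_norm_sq_to_K, ← RCLike.ofReal_pow]
  rfl

/-! ### The Pauli principle -/

/-- In a fermionic state no two particles share the same wave function `ξ`. -/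
theorem IsFermionic.insertAt_adjoint_comp_eq_zero {N : ℕ} {Φ : NBody N} (hΦ : IsFermionic Φ)
    (ξ : OneBody) {j k : Fin N} (hjk : j ≠ k) :
    insertAt j ξ ((insertAt j ξ).adjoint (insertAt k ξ ((insertAt k ξ).adjoint Φ))) = 0 := by
  set E : Fin N → (NBody N →L[ℂ] NBody N) := fun j => insertAt j ξ ∘L (insertAt j ξ).adjoint
    with hE
  -- On a product state E_j E_k replaces the factors j and k by ξ and multiplies by ⟨ξ, f_j⟩⟨ξ,
  -- f_k⟩, which is symmetric under the swap. Antisymmetry of Φ supplies a sign −1, so E_j E_k Φ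
  -- equals its own negative.
  have hswap : E j * E k * permOp (Equiv.swap j k) = E j * E k := by
    refine ext_productState fun f => ?_
    simp only [hE, mul_apply_eq_comp, ContinuousLinearMap.comp_apply,
      permOp_productState, insertAt_adjoint_productState, map_smul, Equiv.symm_swap,
      Function.comp_apply, Equiv.swap_apply_left, Equiv.swap_apply_right,
      Function.update_of_ne hjk, smul_smul]
    rw [mul_comm]
    congr 2
    ext1 i
    by_cases hi : i = j
    · subst hi
      simp
    by_cases hi' : i = k
    · subst hi'
      simp [Function.update_of_ne hi]
    simp [Function.update_of_ne hi, Function.update_of_ne hi',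
      Equiv.swap_apply_of_ne_of_ne hi hi']
  have h1 := congrArg (fun B => B Φ) hswap
  simp only [mul_apply_eq_comp] at h1
  rw [(isFermionic_iff Φ).1 hΦ, Equiv.Perm.sign_swap hjk] at h1
  simp only [Units.val_neg, Units.val_one, Int.cast_neg, Int.cast_one, neg_smul, one_smul,
    map_neg] at h1
  have h2 : (2 : ℂ) • E j (E k Φ) = 0 := by
    rw [two_smul]
    nth_rewrite 1 [← h1]
    exact neg_add_cancel _
  exact (smul_eq_zero.1 h2).resolve_left two_ne_zero

theorem inner_insertAt_adjoint_self {N : ℕ} (j : Fin N) (ξ : OneBody) (Φ : NBody N) :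
    (inner ℂ Φ (insertAt j ξ ((insertAt j ξ).adjoint Φ))) =
      ((‖(insertAt j ξ).adjoint Φ‖ ^ 2 : ℝ) : ℂ) := by
  rw [← ContinuousLinearMap.adjoint_inner_left, inner_self_eq_norm_sq_to_K]
  norm_cast

/-- The occupation number of a one-particle state in a fermionic state is at most one. -/
theorem IsFermionic.sum_norm_adjoint_insertAt_sq_le {N : ℕ} {Φ : NBody N} (hΦ : IsFermionic Φ)
    (ξ : OneBody) :
    ∑ j, ‖(insertAt j ξ).adjoint Φ‖ ^ 2 ≤ ‖ξ‖ ^ 2 * ‖Φ‖ ^ 2 := by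
  set S := ∑ j, ‖(insertAt j ξ).adjoint Φ‖ ^ 2 with hS
  -- With E_j = |ξ⟩⟨ξ| at place j and v = ∑ E_j Φ, one has ⟨Φ, v⟩ = S. The cross terms of ‖v‖²
  -- vanish by the Pauli principle, so ‖v‖² = ‖ξ‖²S, and Cauchy–Schwarz gives S² ≤ ‖Φ‖²‖ξ‖²S.
  set v := ∑ j, insertAt j ξ ((insertAt j ξ).adjoint Φ) with hv
  have hS0 : 0 ≤ S := Finset.sum_nonneg fun _ _ => by positivity
  have h1 : inner ℂ Φ v = (S : ℂ) := by
    rw [hv, inner_sum, hS, Complex.ofReal_sum]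
    exact Finset.sum_congr rfl fun j _ => inner_insertAt_adjoint_self j ξ Φ
  have h2 : ‖v‖ ^ 2 = ‖ξ‖ ^ 2 * S := by
    have : inner ℂ v v = ((‖ξ‖ ^ 2 * S : ℝ) : ℂ) := by
      conv_lhs => rw [hv]
      rw [sum_inner, hS, Finset.mul_sum, Complex.ofReal_sum]
      refine Finset.sum_congr rfl fun j _ => ?_
      rw [← ContinuousLinearMap.adjoint_inner_right, map_sum, inner_sum, Finset.sum_eq_single j]
      · rw [adjoint_insertAt_insertAt, inner_smul_right, inner_self_eq_norm_sq_to_K,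
          inner_self_eq_norm_sq_to_K]
        push_cast
        rfl
      · intro k _ hk
        rw [ContinuousLinearMap.adjoint_inner_left, hΦ.insertAt_adjoint_comp_eq_zero ξ hk.symm]
        simp
      · simp
    rw [inner_self_eq_norm_sq_to_K, ← RCLike.ofReal_pow] at this
    exact Complex.ofReal_injective this
  have h3 : S ≤ ‖Φ‖ * ‖v‖ := by
    have := norm_inner_le_norm (𝕜 := ℂ) Φ v
    rwa [h1, Complex.norm_real, Real.norm_of_nonneg hS0] at this
  have h4 : S * S ≤ (‖ξ‖ ^ 2 * ‖Φ‖ ^ 2) * S := by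
    calc S * S ≤ (‖Φ‖ * ‖v‖) * (‖Φ‖ * ‖v‖) := mul_self_le_mul_self hS0 h3
      _ = ‖Φ‖ ^ 2 * ‖v‖ ^ 2 := by ring
      _ = _ := by rw [h2]; ring
  rcases hS0.eq_or_lt with h0 | h0
  · rw [← h0]; positivity
  · exact le_of_mul_le_mul_right h4 h0

theorem ballAt_projAt_apply {N : ℕ} (φ : Fin N → OneBody) (j : Fin N) (r : ℝ) (z : E3)
    (Φ : NBody N) :
    ballAt j r z (projAt φ j Φ) =
      ∑ i, insertAt j (ballOp r z (φ i)) ((insertAt j (φ i)).adjoint Φ) := by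
  simp only [projAt, sum_apply, ContinuousLinearMap.comp_apply, map_sum,
    ballAt_insertAt]

open scoped MatrixOrder Matrix.Norms.L2Operator in
/-- `dΓ(p X p) ≤ Tr[X p]` on fermionic states. -/
theorem IsFermionic.sum_norm_ballAt_projAt_sq_le {N : ℕ} {φ : Fin N → OneBody}
    (hφ : Orthonormal ℂ φ) {Φ : NBody N} (hΦ : IsFermionic Φ) (r : ℝ) (z : E3) :
    ∑ j, ‖ballAt j r z (projAt φ j Φ)‖ ^ 2 ≤ (∑ i, ‖ballOp r z (φ i)‖ ^ 2) * ‖Φ‖ ^ 2 := by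
  set w : Fin N → OneBody := fun i => ballOp r z (φ i) with hw
  -- Factoring the Gram matrix of the vectors Xφ_i as B*B gives pXp = ∑ |ξ_k⟩⟨ξ_k| with ξ_k = ∑
  -- conj(B_ki) φ_i, without diagonalizing. The occupation bound applies to each ξ_k, and ∑ ‖ξ_k‖² =
  -- Tr[Xp].
  obtain ⟨B, hB⟩ := CStarAlgebra.nonneg_iff_eq_star_mul_self.1
    (Matrix.nonneg_iff_posSemidef.2 (Matrix.posSemidef_gram ℂ w))
  have hB' : ∀ i l, inner ℂ (w i) (w l) = ∑ k, star (B k i) * B k l := fun i l => by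
    have := congrFun (congrFun hB i) l
    simpa [Matrix.gram_apply, Matrix.mul_apply] using this
  set ξ : Fin N → OneBody := fun k => ∑ i, star (B k i) • φ i with hξ
  have hadj : ∀ j k, (insertAt j (ξ k)).adjoint Φ =
      ∑ i, B k i • (insertAt j (φ i)).adjoint Φ := fun j k => by
    rw [hξ, insertAt_sum_smul, map_sum, sum_apply]
    refine Finset.sum_congr rfl fun i _ => ?_
    rw [map_smulₛₗ]
    simp
  have hnorm : ∀ j, ‖ballAt j r z (projAt φ j Φ)‖ ^ 2 =
      ∑ k, ‖(insertAt j (ξ k)).adjoint Φ‖ ^ 2 := fun j => by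
    rw [← Complex.ofReal_inj]
    rw [Complex.ofReal_sum]
    simp only [ofReal_norm_sq_eq_inner, hadj]
    rw [ballAt_projAt_apply]
    simp only [sum_inner, inner_sum, inner_insertAt, inner_smul_left, inner_smul_right,
      Finset.mul_sum]
    refine Eq.trans ?_ Finset.sum_comm
    refine Finset.sum_congr rfl fun i _ => ?_
    refine Eq.trans ?_ Finset.sum_comm
    refine Finset.sum_congr rfl fun l _ => ?_
    rw [hB', Finset.sum_mul]
    refine Finset.sum_congr rfl fun k _ => ?_
    rw [RCLike.star_def]
    ring
  have hξn : ∑ k, ‖ξ k‖ ^ 2 = ∑ i, ‖w i‖ ^ 2 := by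
    have e1 : ∀ k, ‖ξ k‖ ^ 2 = ∑ i, ‖B k i‖ ^ 2 := fun k => by
      rw [← Complex.ofReal_inj, Complex.ofReal_sum, ofReal_norm_sq_eq_inner]
      simp only [hξ]
      rw [hφ.inner_sum]
      refine Finset.sum_congr rfl fun i _ => ?_
      rw [Complex.ofReal_pow, ← Complex.conj_mul', mul_comm, RCLike.star_def, Complex.conj_conj]
    have e2 : ∀ i, ‖w i‖ ^ 2 = ∑ k, ‖B k i‖ ^ 2 := fun i => by
      rw [← Complex.ofReal_inj, Complex.ofReal_sum, ofReal_norm_sq_eq_inner, hB']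
      refine Finset.sum_congr rfl fun k _ => ?_
      rw [Complex.ofReal_pow, ← Complex.conj_mul']
      rfl
    simp only [e1, e2]
    exact Finset.sum_comm
  calc ∑ j, ‖ballAt j r z (projAt φ j Φ)‖ ^ 2
      = ∑ k, ∑ j, ‖(insertAt j (ξ k)).adjoint Φ‖ ^ 2 := by
        simp only [hnorm]
        exact Finset.sum_comm
    _ ≤ ∑ k, ‖ξ k‖ ^ 2 * ‖Φ‖ ^ 2 :=
        Finset.sum_le_sum fun k _ => hΦ.sum_norm_adjoint_insertAt_sq_le (ξ k)
    _ = _ := by rw [← Finset.sum_mul, hξn]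

/-! ### The projections as symmetric idempotents -/

theorem inner_indicatorOp_left {α : Type*} [MeasurableSpace α] (μ : Measure α) (s : Set α)
    (hs : MeasurableSet s) (f g : Lp ℂ 2 μ) :
    inner ℂ (indicatorOp μ s hs f) g = inner ℂ f (indicatorOp μ s hs g) := by
  rw [L2.inner_def, L2.inner_def]
  apply integral_congr_ae
  filter_upwards [coeFn_indicatorOp μ s hs f, coeFn_indicatorOp μ s hs g] with x h1 h2
  rw [h1, h2]
  by_cases hx : x ∈ s <;> simp [hx]

theorem indicatorOp_indicatorOp {α : Type*} [MeasurableSpace α] (μ : Measure α) (s : Set α)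
    (hs : MeasurableSet s) (f : Lp ℂ 2 μ) :
    indicatorOp μ s hs (indicatorOp μ s hs f) = indicatorOp μ s hs f := by
  refine Lp.ext ?_
  filter_upwards [coeFn_indicatorOp μ s hs f,
    coeFn_indicatorOp μ s hs (indicatorOp μ s hs f)] with x h1 h2
  rw [h2]
  by_cases hx : x ∈ s
  · simp [hx]
  · rw [h1]
    simp [hx]

theorem inner_indicatorOp_right {α : Type*} [MeasurableSpace α] (μ : Measure α) (s : Set α)
    (hs : MeasurableSet s) (f g : Lp ℂ 2 μ) :
    inner ℂ f (indicatorOp μ s hs g) =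
      inner ℂ (indicatorOp μ s hs f) (indicatorOp μ s hs g) := by
  rw [inner_indicatorOp_left, indicatorOp_indicatorOp]

theorem inner_ballAt_right {N : ℕ} (j : Fin N) (r : ℝ) (z : E3) (Φ Φ' : NBody N) :
    inner ℂ Φ (ballAt j r z Φ') = inner ℂ (ballAt j r z Φ) (ballAt j r z Φ') :=
  inner_indicatorOp_right _ _ _ _ _

theorem inner_projAt_left {N : ℕ} (φ : Fin N → OneBody) (j : Fin N) (Φ Φ' : NBody N) :
    inner ℂ (projAt φ j Φ) Φ' = inner ℂ Φ (projAt φ j Φ') := by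
  simp only [projAt, sum_apply, ContinuousLinearMap.comp_apply, sum_inner, inner_sum]
  refine Finset.sum_congr rfl fun i _ => ?_
  rw [← ContinuousLinearMap.adjoint_inner_right, ContinuousLinearMap.adjoint_inner_left]

theorem projAt_projAt {N : ℕ} {φ : Fin N → OneBody} (hφ : Orthonormal ℂ φ) (j : Fin N)
    (Φ : NBody N) : projAt φ j (projAt φ j Φ) = projAt φ j Φ := by
  simp only [projAt, sum_apply, ContinuousLinearMap.comp_apply, map_sum,
    adjoint_insertAt_insertAt, orthonormal_iff_ite.1 hφ]
  refine Finset.sum_congr rfl fun i _ => ?_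
  rw [Finset.sum_eq_single i]
  · simp
  · intro k _ hk
    simp [hk]
  · simp

theorem inner_coprojAt_left {N : ℕ} (φ : Fin N → OneBody) (j : Fin N) (Φ Φ' : NBody N) :
    inner ℂ (coprojAt φ j Φ) Φ' = inner ℂ Φ (coprojAt φ j Φ') := by
  simp only [coprojAt, sub_apply, one_apply_eq_self, inner_sub_left, inner_sub_right,
    inner_projAt_left]

theorem coprojAt_coprojAt {N : ℕ} {φ : Fin N → OneBody} (hφ : Orthonormal ℂ φ) (j : Fin N)
    (Φ : NBody N) : coprojAt φ j (coprojAt φ j Φ) = coprojAt φ j Φ := by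
  simp only [coprojAt, sub_apply, one_apply_eq_self, map_sub, projAt_projAt hφ]
  simp

theorem inner_dGamma_coprojAt {N : ℕ} {φ : Fin N → OneBody} (hφ : Orthonormal ℂ φ)
    (Φ : NBody N) :
    inner ℂ Φ (dGamma (coprojAt φ) Φ) = ((∑ j, ‖coprojAt φ j Φ‖ ^ 2 : ℝ) : ℂ) := by
  rw [dGamma, sum_apply, inner_sum, Complex.ofReal_sum]
  refine Finset.sum_congr rfl fun j _ => ?_
  rw [ofReal_norm_sq_eq_inner, inner_coprojAt_left, coprojAt_coprojAt hφ]

theorem norm_projAt_sq_add_norm_coprojAt_sq {N : ℕ} {φ : Fin N → OneBody}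
    (hφ : Orthonormal ℂ φ) (j : Fin N) (Φ : NBody N) :
    ‖projAt φ j Φ‖ ^ 2 + ‖coprojAt φ j Φ‖ ^ 2 = ‖Φ‖ ^ 2 := by
  have h : inner ℂ (projAt φ j Φ) (coprojAt φ j Φ) = 0 := by
    rw [inner_projAt_left, coprojAt, sub_apply, one_apply_eq_self, map_sub,
      projAt_projAt hφ, sub_self, inner_zero_right]
  have h2 := norm_add_sq_eq_norm_sq_add_norm_sq_of_inner_eq_zero _ _ h
  have h3 : projAt φ j Φ + coprojAt φ j Φ = Φ := by
    rw [coprojAt, sub_apply, one_apply_eq_self, add_sub_cancel]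
  rw [h3] at h2
  nlinarith

theorem inner_dGamma_proj_ball_proj {N : ℕ} (φ : Fin N → OneBody) (r : ℝ) (z : E3)
    (Φ Φ' : NBody N) :
    inner ℂ Φ (dGamma (fun j => projAt φ j * ballAt j r z * projAt φ j) Φ') =
      ∑ j, inner ℂ (ballAt j r z (projAt φ j Φ)) (ballAt j r z (projAt φ j Φ')) := by
  rw [dGamma, sum_apply, inner_sum]
  refine Finset.sum_congr rfl fun j _ => ?_
  rw [mul_apply_eq_comp, mul_apply_eq_comp, ← inner_projAt_left, inner_ballAt_right]

theorem inner_dGamma_coproj_ball_proj {N : ℕ} (φ : Fin N → OneBody) (r : ℝ) (z : E3)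
    (Φ Φ' : NBody N) :
    inner ℂ Φ (dGamma (fun j => coprojAt φ j * ballAt j r z * projAt φ j) Φ') =
      ∑ j, inner ℂ (ballAt j r z (coprojAt φ j Φ)) (ballAt j r z (projAt φ j Φ')) := by
  rw [dGamma, sum_apply, inner_sum]
  refine Finset.sum_congr rfl fun j _ => ?_
  rw [mul_apply_eq_comp, mul_apply_eq_comp, ← inner_coprojAt_left, inner_ballAt_right]

/-! ### The pointwise bound on the cancellation term -/

/-- If `D` is symmetric with `0 ≤ D ≤ τ` on the span of `x` and `D x`, then
`‖D x‖² ≤ τ ⟨x, D x⟩`. -/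
theorem norm_apply_sq_le_mul_re_inner {H : Type*} [NormedAddCommGroup H] [InnerProductSpace ℂ H]
    {D : H →L[ℂ] H} (hD : ∀ x y, inner ℂ (D x) y = inner ℂ x (D y)) {τ : ℝ} (hτ : 0 ≤ τ) {x : H}
    (h0 : ∀ t : ℝ, 0 ≤ (inner ℂ (x - (t : ℂ) • D x) (D (x - (t : ℂ) • D x))).re)
    (h1 : (inner ℂ (D x) (D (D x))).re ≤ τ * ‖D x‖ ^ 2)
    (h2 : (inner ℂ x (D x)).re ≤ τ * ‖x‖ ^ 2) :
    ‖D x‖ ^ 2 ≤ τ * (inner ℂ x (D x)).re := by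
  have key : ∀ t : ℝ, 0 ≤ (inner ℂ x (D x)).re - 2 * t * ‖D x‖ ^ 2 +
      t ^ 2 * (inner ℂ (D x) (D (D x))).re := fun t => by
    refine (h0 t).trans_eq ?_
    have e : (inner ℂ (D x) (D x)) = ((‖D x‖ ^ 2 : ℝ) : ℂ) := (ofReal_norm_sq_eq_inner _).symm
    rw [map_sub, map_smul, inner_sub_left, inner_sub_right, inner_sub_right, inner_smul_left,
      inner_smul_left, inner_smul_right, inner_smul_right, ← hD x (D x), e]
    simp only [Complex.sub_re, Complex.conj_ofReal, Complex.re_ofReal_mul, Complex.ofReal_re]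
    ring
  -- For τ > 0 the optimal choice is t = 1/τ. For τ = 0 both ⟨x, Dx⟩ and ⟨Dx, D Dx⟩ are nonpositive,
  -- and t = 1 already forces Dx = 0.
  rcases hτ.eq_or_lt with rfl | hτ
  · have := key 1
    linarith
  · have h3 := key τ⁻¹
    have h4 : τ * (τ⁻¹ ^ 2 * (inner ℂ (D x) (D (D x))).re) ≤ ‖D x‖ ^ 2 := by
      calc τ * (τ⁻¹ ^ 2 * (inner ℂ (D x) (D (D x))).re)
          ≤ τ * (τ⁻¹ ^ 2 * (τ * ‖D x‖ ^ 2)) := by gcongr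
        _ = ‖D x‖ ^ 2 := by field_simp
    have h5 := mul_nonneg hτ.le h3
    have h6 : τ * (2 * τ⁻¹ * ‖D x‖ ^ 2) = 2 * ‖D x‖ ^ 2 := by field_simp
    linarith

/-- The trace `Tr[X p]` for `X = X_{r,z}`. -/
def ballTrace {N : ℕ} (φ : Fin N → OneBody) (r : ℝ) (z : E3) : ℝ :=
  ∑ i, ‖ballOp r z (φ i)‖ ^ 2

theorem ballTrace_nonneg {N : ℕ} (φ : Fin N → OneBody) (r : ℝ) (z : E3) :
    0 ≤ ballTrace φ r z :=
  Finset.sum_nonneg fun _ _ => by positivity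

/-- The expectation of `Tr[X p] - dΓ(p X p)`. -/
def holeBall {N : ℕ} (φ : Fin N → OneBody) (r : ℝ) (z : E3) (χ : NBody N) : ℝ :=
  ballTrace φ r z * ‖χ‖ ^ 2 - ∑ j, ‖ballAt j r z (projAt φ j χ)‖ ^ 2

/-- The expectation of `dΓ(q X q)`. -/
def evaporatedBall {N : ℕ} (φ : Fin N → OneBody) (r : ℝ) (z : E3) (Φ : NBody N) : ℝ :=
  ∑ j, ‖ballAt j r z (coprojAt φ j Φ)‖ ^ 2

theorem evaporatedBall_nonneg {N : ℕ} (φ : Fin N → OneBody) (r : ℝ) (z : E3) (Φ : NBody N) :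
    0 ≤ evaporatedBall φ r z Φ :=
  Finset.sum_nonneg fun _ _ => by positivity

theorem IsFermionic.holeBall_nonneg {N : ℕ} {φ : Fin N → OneBody} (hφ : Orthonormal ℂ φ)
    {χ : NBody N} (hχ : IsFermionic χ) (r : ℝ) (z : E3) : 0 ≤ holeBall φ r z χ :=
  sub_nonneg.2 (hχ.sum_norm_ballAt_projAt_sq_le hφ r z)

/-- The operator `Tr[X p] - dΓ(p X p)`. -/
def holeOp {N : ℕ} (φ : Fin N → OneBody) (r : ℝ) (z : E3) : NBody N →L[ℂ] NBody N :=
  (ballTrace φ r z : ℂ) • 1 - dGamma (fun j => projAt φ j * ballAt j r z * projAt φ j)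

theorem inner_holeOp {N : ℕ} (φ : Fin N → OneBody) (r : ℝ) (z : E3) (Φ Φ' : NBody N) :
    inner ℂ Φ (holeOp φ r z Φ') = ballTrace φ r z * inner ℂ Φ Φ' -
      ∑ j, inner ℂ (ballAt j r z (projAt φ j Φ)) (ballAt j r z (projAt φ j Φ')) := by
  rw [holeOp, sub_apply, smul_apply, inner_sub_right, inner_dGamma_proj_ball_proj,
    inner_smul_right, one_apply_eq_self]

theorem re_inner_holeOp {N : ℕ} (φ : Fin N → OneBody) (r : ℝ) (z : E3) (χ : NBody N) :
    (inner ℂ χ (holeOp φ r z χ)).re = holeBall φ r z χ := by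
  rw [inner_holeOp, ← ofReal_norm_sq_eq_inner,
    Finset.sum_congr rfl fun j _ => (ofReal_norm_sq_eq_inner (ballAt j r z (projAt φ j χ))).symm,
    ← Complex.ofReal_sum, ← Complex.ofReal_mul, ← Complex.ofReal_sub, Complex.ofReal_re]
  rfl

theorem inner_holeOp_left {N : ℕ} (φ : Fin N → OneBody) (r : ℝ) (z : E3) (Φ Φ' : NBody N) :
    inner ℂ (holeOp φ r z Φ) Φ' = inner ℂ Φ (holeOp φ r z Φ') := by
  rw [← inner_conj_symm, inner_holeOp, inner_holeOp]
  simp only [map_sub, map_mul, map_sum, Complex.conj_ofReal, inner_conj_symm]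

theorem permOp_holeOp {N : ℕ} (φ : Fin N → OneBody) (r : ℝ) (z : E3) (σ : Equiv.Perm (Fin N)) :
    permOp σ * holeOp φ r z = holeOp φ r z * permOp σ := by
  rw [holeOp, mul_sub, sub_mul, permOp_dGamma_proj_ball_proj, mul_smul_comm, smul_mul_assoc,
    mul_one, one_mul]

/-- This is D² ≤ τD. The lower bound D ≥ 0 is available on antisymmetric vectors, which suffices
because D preserves antisymmetry; the upper bound D ≤ τ holds on every vector since dΓ(pXp) ≥ 0. -/
theorem IsFermionic.norm_holeOp_sq_le {N : ℕ} {φ : Fin N → OneBody} (hφ : Orthonormal ℂ φ)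
    {χ : NBody N} (hχ : IsFermionic χ) (r : ℝ) (z : E3) :
    ‖holeOp φ r z χ‖ ^ 2 ≤ ballTrace φ r z * holeBall φ r z χ := by
  have hle : ∀ Φ : NBody N,
      (inner ℂ Φ (holeOp φ r z Φ)).re ≤ ballTrace φ r z * ‖Φ‖ ^ 2 := fun Φ => by
    rw [re_inner_holeOp, holeBall]
    exact sub_le_self _ (Finset.sum_nonneg fun _ _ => by positivity)
  rw [← re_inner_holeOp]
  refine norm_apply_sq_le_mul_re_inner (inner_holeOp_left φ r z) (ballTrace_nonneg φ r z)
    (fun t => ?_) (hle _) (hle _)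
  have hf : IsFermionic (χ - (t : ℂ) • holeOp φ r z χ) :=
    hχ.map (A := 1 - (t : ℂ) • holeOp φ r z) fun σ => by
      rw [mul_sub, sub_mul, mul_smul_comm, smul_mul_assoc, permOp_holeOp, mul_one, one_mul]
  rw [re_inner_holeOp]
  exact hf.holeBall_nonneg hφ r z

/-- With w = Dχ the matrix element is ∑ ⟨X_j q_j Φ, X_j p_j w⟩. Cauchy–Schwarz bounds its square by
a·τ‖w‖² ≤ τ²ab, using dΓ(pXp) ≤ τ on w and D² ≤ τD on χ. The arithmetic–geometric mean inequality
finishes. -/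
theorem IsFermionic.norm_inner_dGamma_holeOp_le {N : ℕ} {φ : Fin N → OneBody}
    (hφ : Orthonormal ℂ φ) {χ : NBody N} (hχ : IsFermionic χ) (Φ : NBody N) (r : ℝ) (z : E3) :
    2 * ‖inner ℂ Φ (dGamma (fun j => coprojAt φ j * ballAt j r z * projAt φ j)
        (holeOp φ r z χ))‖ ≤
      ballTrace φ r z * (evaporatedBall φ r z Φ + holeBall φ r z χ) := by
  set τ := ballTrace φ r z with hτ
  set a := evaporatedBall φ r z Φ with ha
  set b := holeBall φ r z χ with hb
  set w := holeOp φ r z χ with hw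
  have hτ0 : 0 ≤ τ := ballTrace_nonneg φ r z
  have ha0 : 0 ≤ a := evaporatedBall_nonneg φ r z Φ
  have hb0 : 0 ≤ b := hχ.holeBall_nonneg hφ r z
  have hwf : IsFermionic w := hχ.map (permOp_holeOp φ r z)
  have h1 : ∑ j, ‖ballAt j r z (projAt φ j w)‖ ^ 2 ≤ τ ^ 2 * b := by
    calc _ ≤ τ * ‖w‖ ^ 2 := hwf.sum_norm_ballAt_projAt_sq_le hφ r z
      _ ≤ τ * (τ * b) := by gcongr; exact hχ.norm_holeOp_sq_le hφ r z
      _ = τ ^ 2 * b := by ring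
  rw [inner_dGamma_coproj_ball_proj]
  set n := ‖∑ j, inner ℂ (ballAt j r z (coprojAt φ j Φ)) (ballAt j r z (projAt φ j w))‖ with hn
  have h2 : n ≤ ∑ j, ‖ballAt j r z (coprojAt φ j Φ)‖ * ‖ballAt j r z (projAt φ j w)‖ :=
    (norm_sum_le _ _).trans (Finset.sum_le_sum fun j _ => norm_inner_le_norm _ _)
  have h3 : n ^ 2 ≤ a * (τ ^ 2 * b) :=
    calc n ^ 2 ≤ _ := pow_le_pow_left₀ (norm_nonneg _) h2 2
      _ ≤ _ := Finset.sum_mul_sq_le_sq_mul_sq _ _ _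
      _ ≤ _ := mul_le_mul_of_nonneg_left h1 ha0
  refine abs_le_of_sq_le_sq' (?_ : (2 * n) ^ 2 ≤ _) (by positivity) |>.2
  nlinarith [mul_nonneg (sq_nonneg τ) (sq_nonneg (a - b))]

/-! ### Traces of rank-one operators -/

/-- Parseval's identity; in particular the value does not depend on the basis chosen in `opTrace`.
-/
theorem opTrace_rankOne {H : Type*} [NormedAddCommGroup H] [InnerProductSpace ℂ H]
    [CompleteSpace H] (x y : H) : opTrace (InnerProductSpace.rankOne ℂ x y) = inner ℂ y x := by
  rw [opTrace, ← HilbertBasis.tsum_inner_mul_inner (exists_hilbertBasis ℂ H).choose_spec.choose y x]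
  refine tsum_congr fun i => ?_
  rw [InnerProductSpace.rankOne_apply, inner_smul_right]

theorem opTrace_ballOp_mul_hfProj {N : ℕ} (φ : Fin N → OneBody) (r : ℝ) (z : E3) :
    opTrace (ballOp r z * hfProj φ) = (ballTrace φ r z : ℂ) := by
  set b := (exists_hilbertBasis ℂ OneBody).choose_spec.choose with hb
  have hs : HasSum (fun i => inner ℂ (b i) ((ballOp r z * hfProj φ) (b i)))
      (∑ k, inner ℂ (φ k) (ballOp r z (φ k))) := by
    have e : (fun i => inner ℂ (b i) ((ballOp r z * hfProj φ) (b i))) =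
        fun i => ∑ k, inner ℂ (φ k) (b i) * inner ℂ (b i) (ballOp r z (φ k)) :=
      funext fun i => by
        simp only [mul_apply_eq_comp, hfProj, sum_apply, InnerProductSpace.rankOne_apply, map_sum,
          map_smul, inner_sum, inner_smul_right]
    rw [e]
    exact hasSum_sum fun k _ => b.hasSum_inner_mul_inner (φ k) (ballOp r z (φ k))
  rw [opTrace, hs.tsum_eq, ballTrace, Complex.ofReal_sum]
  refine Finset.sum_congr rfl fun k _ => ?_
  rw [ofReal_norm_sq_eq_inner]
  exact inner_indicatorOp_right _ _ _ _ _

theorem isSelfAdjoint_hat {N : ℕ} (φ : Fin N → OneBody) (g : ℝ → ℝ) :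
    IsSelfAdjoint (hat φ g) :=
  cfc_predicate g _

theorem rhoShift_eq_rankOne {N : ℕ} (φ : Fin N → OneBody) (g : ℝ → ℝ) (Ψ : NBody N) (j : ℤ) :
    rhoShift φ g Ψ j = InnerProductSpace.rankOne ℂ
      (hat φ (fun y => Real.sqrt (shiftBy (-j) g y - g y)) Ψ)
      (hat φ (fun y => Real.sqrt (g y - shiftBy j g y)) Ψ) := by
  ext1 Φ
  have h := (isSelfAdjoint_hat φ (fun y => Real.sqrt (g y - shiftBy j g y))).adjoint_eq
  rw [rhoShift, pureState, mul_apply_eq_comp, mul_apply_eq_comp, InnerProductSpace.rankOne_apply,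
    InnerProductSpace.rankOne_apply, map_smul, ← ContinuousLinearMap.adjoint_inner_left, h]

/-- The trace against a rank-one operator is a matrix element. The minus sign appears because the
bracket dΓ(pXp) − Tr[Xp] is −D. -/
theorem cancellationIntegrand_eq {N : ℕ} (φ : Fin N → OneBody) (g : ℝ → ℝ) (Ψ : NBody N)
    (ω : ℝ × E3) :
    cancellationIntegrand φ g Ψ ω =
      -(2 * (inner ℂ (hat φ (fun y => Real.sqrt (g y - shiftBy 1 g y)) Ψ)
        (dGamma (fun j => coprojAt φ j * ballAt j ω.1 ω.2 * projAt φ j)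
          (holeOp φ ω.1 ω.2
            (hat φ (fun y => Real.sqrt (shiftBy (-1) g y - g y)) Ψ)))).im) := by
  have h : ∀ (A : NBody N →L[ℂ] NBody N) (x y : NBody N),
      A * InnerProductSpace.rankOne ℂ x y = InnerProductSpace.rankOne ℂ (A x) y := fun A x y => by
    ext1 Φ
    rw [mul_apply_eq_comp, InnerProductSpace.rankOne_apply, InnerProductSpace.rankOne_apply,
      map_smul]
  rw [cancellationIntegrand, rhoShift_eq_rankOne, h, opTrace_rankOne, opTrace_ballOp_mul_hfProj,
    ← neg_sub, ← holeOp, mul_neg, neg_apply, inner_neg_right, Complex.neg_im, mul_neg,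
    mul_apply_eq_comp]

theorem evaporation_eq {N : ℕ} (φ : Fin N → OneBody) (g : ℝ → ℝ) (Ψ : NBody N) :
    evaporation φ g Ψ = (inner ℂ Ψ (hat φ g Ψ)).re := by
  have h : pureState Ψ * hat φ g = InnerProductSpace.rankOne ℂ Ψ (hat φ g Ψ) := by
    ext1 Φ
    have h := (isSelfAdjoint_hat φ g).adjoint_eq
    rw [pureState, mul_apply_eq_comp, InnerProductSpace.rankOne_apply,
      InnerProductSpace.rankOne_apply, ← ContinuousLinearMap.adjoint_inner_left, h]
  rw [evaporation, h, opTrace_rankOne, ← inner_conj_symm, Complex.conj_re]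

/-! ### Functional calculus of the number of evaporated particles -/

theorem commute_functionalCalculus {H : Type*} [NormedAddCommGroup H] [InnerProductSpace ℂ H]
    [CompleteSpace H] {T A : H →L[ℂ] H} (h : A * T = T * A) (g : ℝ → ℝ) :
    A * functionalCalculus g T = functionalCalculus g T * A :=
  ((show Commute T A from h.symm).cfc_real g).eq.symm

/-- If `y h(y)² ≤ g(y)` for `y ≥ 0` and `T ≥ 0`, then `h(T) T h(T) ≤ g(T)`. -/
theorem re_inner_functionalCalculus_le {H : Type*} [NormedAddCommGroup H]
    [InnerProductSpace ℂ H] [CompleteSpace H] {T : H →L[ℂ] H} (hT : T.IsPositive) {h g : ℝ → ℝ}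
    (hh : Continuous h) (hg : Continuous g) (hle : ∀ y, 0 ≤ y → y * h y ^ 2 ≤ g y) (x : H) :
    (inner ℂ (functionalCalculus h T x) (T (functionalCalculus h T x))).re ≤
      (inner ℂ x (functionalCalculus g T x)).re := by
  have hT0 : 0 ≤ T := (ContinuousLinearMap.nonneg_iff_isPositive T).2 hT
  have hTs : IsSelfAdjoint T := hT.isSelfAdjoint
  have h1 : cfc h T * (T * cfc h T) ≤ cfc g T := by
    have e : cfc h T * (T * cfc h T) = cfc (fun y => h y * (id y * h y)) T := by
      rw [cfc_mul h (fun y => id y * h y) T hh.continuousOn (continuous_id.mul hh).continuousOn,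
        cfc_mul id h T continuousOn_id hh.continuousOn, cfc_id ℝ T hTs]
    rw [e]
    -- Positivity of T places its spectrum in [0, ∞), so the scalar inequality is needed only there.
    refine cfc_mono (fun y hy => ?_) (hh.mul (continuous_id.mul hh)).continuousOn hg.continuousOn
    refine le_trans (le_of_eq ?_) (hle y (spectrum_nonneg_of_nonneg hT0 hy))
    simp only [id]
    ring
  have h2 := ((ContinuousLinearMap.le_def _ _).1 h1).re_inner_nonneg_right x
  have h3 : IsSelfAdjoint (cfc h T) := cfc_predicate h T
  rw [sub_apply, inner_sub_right, map_sub, mul_apply_eq_comp, mul_apply_eq_comp,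
    ← ContinuousLinearMap.adjoint_inner_left (cfc h T), h3.adjoint_eq] at h2
  exact sub_nonneg.1 h2

theorem isPositive_dGamma_coprojAt {N : ℕ} {φ : Fin N → OneBody} (hφ : Orthonormal ℂ φ) :
    (dGamma (coprojAt φ)).IsPositive := by
  rw [ContinuousLinearMap.isPositive_iff_complex]
  intro Φ
  have h : inner ℂ (dGamma (coprojAt φ) Φ) Φ = ((∑ j, ‖coprojAt φ j Φ‖ ^ 2 : ℝ) : ℂ) := by
    rw [← inner_conj_symm, inner_dGamma_coprojAt hφ, Complex.conj_ofReal]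
  rw [h]
  refine ⟨rfl, ?_⟩
  rw [RCLike.re_eq_complex_re, Complex.ofReal_re]
  exact Finset.sum_nonneg fun j _ => sq_nonneg ‖coprojAt φ j Φ‖

theorem IsFermionic.hat_apply {N : ℕ} {Ψ : NBody N} (hΨ : IsFermionic Ψ) (φ : Fin N → OneBody)
    (g : ℝ → ℝ) : IsFermionic (hat φ g Ψ) :=
  hΨ.map fun σ => commute_functionalCalculus (permOp_dGamma_coprojAt φ σ) g

theorem sum_norm_coprojAt_hat_sq_le {N : ℕ} {φ : Fin N → OneBody} (hφ : Orthonormal ℂ φ)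
    (Ψ : NBody N) {h g : ℝ → ℝ} (hh : Continuous h) (hg : Continuous g)
    (hle : ∀ y, 0 ≤ y → y * h y ^ 2 ≤ g y) :
    ∑ j, ‖coprojAt φ j (hat φ h Ψ)‖ ^ 2 ≤ evaporation φ g Ψ := by
  have h1 := re_inner_functionalCalculus_le (isPositive_dGamma_coprojAt hφ) hh hg hle Ψ
  rw [evaporation_eq]
  refine le_trans (le_of_eq ?_) h1
  rw [inner_dGamma_coprojAt hφ, Complex.ofReal_re]
  rfl

/-! ### The weight g_θ -/

/-- The two pieces meet at N^θ because N^{1−θ}N^θ = N. In this clamped form continuity, needed for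
the functional calculus, and monotonicity are immediate. -/
theorem gTheta_eq {N : ℕ} (hN : 1 ≤ N) (θ x : ℝ) :
    gTheta N θ x = max 0 (min ((N : ℝ) ^ (1 - θ) * x) N) := by
  have hN0 : (0 : ℝ) < N := by exact_mod_cast hN
  have ha : (0 : ℝ) < (N : ℝ) ^ (1 - θ) := Real.rpow_pos_of_pos hN0 _
  have hb : (N : ℝ) ^ (1 - θ) * (N : ℝ) ^ θ = N := by
    rw [← Real.rpow_add hN0, sub_add_cancel, Real.rpow_one]
  have hc : (0 : ℝ) < (N : ℝ) ^ θ := Real.rpow_pos_of_pos hN0 _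
  rw [gTheta]
  rcases lt_or_ge x 0 with hx | hx
  · rw [Set.indicator_of_notMem (by simp [hx]),
      Set.indicator_of_notMem (by simp only [Set.mem_Ioi, not_lt]; linarith)]
    rw [max_eq_left]
    · ring
    · exact (min_le_left _ _).trans (mul_nonpos_of_nonneg_of_nonpos ha.le hx.le)
  rcases le_or_gt x ((N : ℝ) ^ θ) with hx' | hx'
  · have : (N : ℝ) ^ (1 - θ) * x ≤ N := by
      exact (mul_le_mul_of_nonneg_left hx' ha.le).trans_eq hb
    rw [Set.indicator_of_mem (by exact ⟨hx, hx'⟩), Set.indicator_of_notMem (by simpa using hx'),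
      min_eq_left this, max_eq_right (by positivity)]
    simp
  · have : (N : ℝ) ≤ (N : ℝ) ^ (1 - θ) * x := by
      exact hb.symm.trans_le (mul_le_mul_of_nonneg_left hx'.le ha.le)
    rw [Set.indicator_of_notMem (by simp [hx']), Set.indicator_of_mem (by exact hx'),
      min_eq_right this, max_eq_right (by positivity)]
    simp

theorem continuous_gTheta {N : ℕ} (hN : 1 ≤ N) (θ : ℝ) : Continuous (gTheta N θ) := by
  rw [funext (gTheta_eq hN θ)]
  fun_prop

theorem monotone_gTheta {N : ℕ} (hN : 1 ≤ N) (θ : ℝ) : Monotone (gTheta N θ) := fun x y hxy => by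
  rw [gTheta_eq hN, gTheta_eq hN]
  gcongr

theorem gTheta_nonneg {N : ℕ} (hN : 1 ≤ N) (θ x : ℝ) : 0 ≤ gTheta N θ x := by
  rw [gTheta_eq hN]
  exact le_max_left _ _

/-- On the half-line g_θ is the minimum of a linear function and a constant, so g_θ(x)/x is
nonincreasing; the form without division also covers x = 0. -/
theorem mul_gTheta_le {N : ℕ} (hN : 1 ≤ N) (θ : ℝ) {x y : ℝ} (hx : 0 ≤ x) (hxy : x ≤ y) :
    x * gTheta N θ y ≤ y * gTheta N θ x := by
  have hN0 : (0 : ℝ) < N := by exact_mod_cast hN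
  have ha : (0 : ℝ) < (N : ℝ) ^ (1 - θ) := Real.rpow_pos_of_pos hN0 _
  have hy := hx.trans hxy
  rw [gTheta_eq hN, gTheta_eq hN, max_eq_right (le_min (by positivity) hN0.le),
    max_eq_right (le_min (by positivity) hN0.le), mul_min_of_nonneg _ _ hx,
    mul_min_of_nonneg _ _ hy]
  refine le_min ((min_le_left _ _).trans_eq (by ring)) ((min_le_right _ _).trans ?_)
  gcongr

theorem mul_sqrt_gTheta_sub_sq_le {N : ℕ} (hN : 1 ≤ N) (θ : ℝ) {y : ℝ} (hy : 0 ≤ y) :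
    y * Real.sqrt (gTheta N θ y - shiftBy 1 (gTheta N θ) y) ^ 2 ≤ gTheta N θ y := by
  have hs : shiftBy 1 (gTheta N θ) y = gTheta N θ (y - 1) := by simp [shiftBy]
  rw [hs, Real.sq_sqrt (sub_nonneg.2 (monotone_gTheta hN θ (by linarith)))]
  -- For y ≥ 1 the monotonicity of g(x)/x is used between y − 1 and y. For y < 1 the point y − 1 is
  -- negative, and y g(y) ≤ g(y) together with g(y − 1) ≥ 0 suffices.
  rcases le_or_gt 1 y with h1 | h1
  · have := mul_gTheta_le hN θ (x := y - 1) (y := y) (by linarith) (by linarith)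
    linarith
  · have h2 := gTheta_nonneg hN θ (y - 1)
    have h3 := gTheta_nonneg hN θ y
    nlinarith [mul_nonneg hy h2]

theorem mul_sqrt_sub_gTheta_sq_le {N : ℕ} (hN : 1 ≤ N) (θ : ℝ) {y : ℝ} (hy : 0 ≤ y) :
    y * Real.sqrt (shiftBy (-1) (gTheta N θ) y - gTheta N θ y) ^ 2 ≤ gTheta N θ y := by
  have hs : shiftBy (-1) (gTheta N θ) y = gTheta N θ (y + 1) := by simp [shiftBy]
  rw [hs, Real.sq_sqrt (sub_nonneg.2 (monotone_gTheta hN θ (by linarith)))]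
  have := mul_gTheta_le hN θ (x := y) (y := y + 1) hy (by linarith)
  linarith

theorem sum_norm_coprojAt_hat_gTheta_sub_sq_le {N : ℕ} (hN : 1 ≤ N) (θ : ℝ)
    {φ : Fin N → OneBody} (hφ : Orthonormal ℂ φ) (Ψ : NBody N) :
    ∑ j, ‖coprojAt φ j
        (hat φ (fun y => Real.sqrt (gTheta N θ y - shiftBy 1 (gTheta N θ) y)) Ψ)‖ ^ 2 ≤
      evaporation φ (gTheta N θ) Ψ := by
  have hc := continuous_gTheta hN θ
  refine sum_norm_coprojAt_hat_sq_le hφ Ψ ?_ hc fun y hy => mul_sqrt_gTheta_sub_sq_le hN θ hy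
  unfold shiftBy
  fun_prop

theorem sum_norm_coprojAt_hat_sub_gTheta_sq_le {N : ℕ} (hN : 1 ≤ N) (θ : ℝ)
    {φ : Fin N → OneBody} (hφ : Orthonormal ℂ φ) (Ψ : NBody N) :
    ∑ j, ‖coprojAt φ j
        (hat φ (fun y => Real.sqrt (shiftBy (-1) (gTheta N θ) y - gTheta N θ y)) Ψ)‖ ^ 2 ≤
      evaporation φ (gTheta N θ) Ψ := by
  have hc := continuous_gTheta hN θ
  refine sum_norm_coprojAt_hat_sq_le hφ Ψ ?_ hc fun y hy => mul_sqrt_sub_gTheta_sq_le hN θ hy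
  unfold shiftBy
  fun_prop

/-! ### Continuity in the ball -/

/-- Multiplication by `1_{|u(x) - z| ≤ r}` depends continuously on `(r, z)` in the strong operator
topology if the level sets of `|u - z|` are null sets. -/
theorem continuous_indicatorOp_closedBall {α : Type*} [MeasurableSpace α] {μ : Measure α}
    {u : α → E3} (hu : Measurable u) (hs : ∀ z r, μ (u ⁻¹' Metric.sphere z r) = 0)
    (η : Lp ℂ 2 μ) :
    Continuous fun ω : ℝ × E3 => indicatorOp μ (u ⁻¹' Metric.closedBall ω.2 ω.1)
      (hu Metric.isClosed_closedBall.measurableSet) η := by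
  rw [continuous_iff_continuousAt]
  intro ω₀
  set s : ℝ × E3 → Set α := fun ω => u ⁻¹' Metric.closedBall ω.2 ω.1 with hsdef
  have hsm : ∀ ω, MeasurableSet (s ω) := fun ω => hu Metric.isClosed_closedBall.measurableSet
  have hη := (memLp_two_iff_integrable_sq_norm (Lp.memLp η).1).1 (Lp.memLp η)
  have hnorm : ∀ ω, ‖indicatorOp μ (s ω) (hsm ω) η - indicatorOp μ (s ω₀) (hsm ω₀) η‖ ^ 2 =
      ∫ x, ‖(s ω).indicator η x - (s ω₀).indicator η x‖ ^ 2 ∂μ := fun ω => by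
    rw [norm_sq_eq_integral]
    apply integral_congr_ae
    filter_upwards [Lp.coeFn_sub (indicatorOp μ (s ω) (hsm ω) η)
      (indicatorOp μ (s ω₀) (hsm ω₀) η), coeFn_indicatorOp μ (s ω) (hsm ω) η,
      coeFn_indicatorOp μ (s ω₀) (hsm ω₀) η] with x h1 h2 h3
    rw [h1, Pi.sub_apply, h2, h3]
  have hlim : Filter.Tendsto
      (fun ω => ∫ x, ‖(s ω).indicator η x - (s ω₀).indicator η x‖ ^ 2 ∂μ) (nhds ω₀)
      (nhds (∫ _, (0 : ℝ) ∂μ)) := by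
    refine tendsto_integral_filter_of_dominated_convergence (fun x => ‖η x‖ ^ 2) ?_ ?_ hη ?_
    · refine Filter.Eventually.of_forall fun ω => ?_
      exact ((((Lp.memLp η).1.indicator (hsm ω)).sub
        ((Lp.memLp η).1.indicator (hsm ω₀))).norm.pow 2)
    · refine Filter.Eventually.of_forall fun ω => Filter.Eventually.of_forall fun x => ?_
      by_cases h1 : x ∈ s ω <;> by_cases h2 : x ∈ s ω₀ <;> simp [h1, h2]
    -- Off the sphere bounding the ball of ω₀, membership in the ball is locally constant in ω, so
    -- the integrand is eventually 0.
    · have hae : ∀ᵐ x ∂μ, x ∉ u ⁻¹' Metric.sphere ω₀.2 ω₀.1 :=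
        measure_eq_zero_iff_ae_notMem.1 (hs _ _)
      filter_upwards [hae] with x hx
      have hev : ∀ᶠ ω in nhds ω₀, (x ∈ s ω ↔ x ∈ s ω₀) := by
        have hc1 : Continuous fun ω : ℝ × E3 => dist (u x) ω.2 := by fun_prop
        have hc2 : Continuous fun ω : ℝ × E3 => ω.1 := continuous_fst
        rcases lt_trichotomy (dist (u x) ω₀.2) ω₀.1 with h | h | h
        · filter_upwards [hc1.continuousAt.eventually_lt hc2.continuousAt h] with ω hω
          exact iff_of_true (Metric.mem_closedBall.2 hω.le) (Metric.mem_closedBall.2 h.le)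
        · exact absurd (Metric.mem_sphere.2 h) hx
        · filter_upwards [hc2.continuousAt.eventually_lt hc1.continuousAt h] with ω hω
          exact iff_of_false (fun h' => (Metric.mem_closedBall.1 h').not_gt hω)
            (fun h' => (Metric.mem_closedBall.1 h').not_gt h)
      refine tendsto_const_nhds.congr' ?_
      filter_upwards [hev] with ω hω
      by_cases h2 : x ∈ s ω₀
      · simp [h2, hω.2 h2]
      · simp [h2, mt hω.1 h2]
  rw [integral_zero] at hlim
  have hlim2 : Filter.Tendsto
      (fun ω => ‖indicatorOp μ (s ω) (hsm ω) η - indicatorOp μ (s ω₀) (hsm ω₀) η‖)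
      (nhds ω₀) (nhds 0) := by
    have := (hlim.congr fun ω => (hnorm ω).symm).sqrt
    rw [Real.sqrt_zero] at this
    exact this.congr fun ω => Real.sqrt_sq (norm_nonneg _)
  exact tendsto_iff_norm_sub_tendsto_zero.2 hlim2

theorem continuous_ballOp (u : OneBody) : Continuous fun ω : ℝ × E3 => ballOp ω.1 ω.2 u :=
  continuous_indicatorOp_closedBall measurable_id (fun z r => Measure.addHaar_sphere _ z r) u

theorem continuous_ballAt {N : ℕ} (j : Fin N) (Φ : NBody N) :
    Continuous fun ω : ℝ × E3 => ballAt j ω.1 ω.2 Φ :=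
  continuous_indicatorOp_closedBall (measurable_pi_apply j)
    (fun z r => (quasiMeasurePreserving_eval j).preimage_null (Measure.addHaar_sphere _ z r)) Φ

theorem continuous_ballTrace {N : ℕ} (φ : Fin N → OneBody) :
    Continuous fun ω : ℝ × E3 => ballTrace φ ω.1 ω.2 :=
  continuous_finsetSum _ fun i _ => (continuous_ballOp (φ i)).norm.pow 2

theorem continuous_evaporatedBall {N : ℕ} (φ : Fin N → OneBody) (Φ : NBody N) :
    Continuous fun ω : ℝ × E3 => evaporatedBall φ ω.1 ω.2 Φ :=
  continuous_finsetSum _ fun j _ => (continuous_ballAt j (coprojAt φ j Φ)).norm.pow 2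

theorem continuous_holeBall {N : ℕ} (φ : Fin N → OneBody) (χ : NBody N) :
    Continuous fun ω : ℝ × E3 => holeBall φ ω.1 ω.2 χ :=
  ((continuous_ballTrace φ).mul continuous_const).sub
    (continuous_finsetSum _ fun j _ => (continuous_ballAt j (projAt φ j χ)).norm.pow 2)

theorem continuous_holeOp {N : ℕ} (φ : Fin N → OneBody) (χ : NBody N) :
    Continuous fun ω : ℝ × E3 => holeOp φ ω.1 ω.2 χ := by
  simp only [holeOp, dGamma, sub_apply, smul_apply, one_apply_eq_self, sum_apply,
    mul_apply_eq_comp]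
  refine ((Complex.continuous_ofReal.comp (continuous_ballTrace φ)).smul continuous_const).sub
    (continuous_finsetSum _ fun j _ => ?_)
  exact (projAt φ j).continuous.comp (continuous_ballAt j _)

/-- Continuity in (r, z) supplies the measurability needed for Tonelli's theorem and for
integrability. -/
theorem continuous_cancellationIntegrand {N : ℕ} (φ : Fin N → OneBody) (g : ℝ → ℝ)
    (Ψ : NBody N) : Continuous (cancellationIntegrand φ g Ψ) := by
  rw [funext (cancellationIntegrand_eq φ g Ψ)]
  refine (continuous_const.mul (Complex.continuous_im.comp ?_)).neg
  simp only [inner_dGamma_coproj_ball_proj]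
  refine continuous_finsetSum _ fun j _ => ?_
  -- The right-hand vector depends on ω through D. Since X is a symmetric idempotent, one copy of it
  -- can be dropped there, so the remaining X acts on a fixed vector and strong continuity applies.
  have h : ∀ (ω : ℝ × E3) (Φ Φ' : NBody N), inner ℂ (ballAt j ω.1 ω.2 Φ) (ballAt j ω.1 ω.2 Φ') =
      inner ℂ (ballAt j ω.1 ω.2 Φ) Φ' := fun ω Φ Φ' => by
    rw [← inner_ballAt_right]
    exact (inner_indicatorOp_left _ _ _ _ _).symm
  simp only [h]
  exact (continuous_ballAt j _).inner ((projAt φ j).continuous.comp (continuous_holeOp φ _))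

/-! ### Integration over the centre of the ball -/

theorem ofReal_norm_sq_eq_lintegral {α : Type*} [MeasurableSpace α] {μ : Measure α}
    (f : Lp ℂ 2 μ) : ENNReal.ofReal (‖f‖ ^ 2) = ∫⁻ x, ‖f x‖ₑ ^ 2 ∂μ := by
  rw [norm_sq_eq_integral, ofReal_integral_eq_lintegral_ofReal
    ((memLp_two_iff_integrable_sq_norm (Lp.memLp f).1).1 (Lp.memLp f))
    (Filter.Eventually.of_forall fun x => sq_nonneg ‖f x‖)]
  simp only [ENNReal.ofReal_pow (norm_nonneg _), ofReal_norm]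

theorem ofReal_norm_indicatorOp_sq_eq_lintegral {α : Type*} [MeasurableSpace α] {μ : Measure α}
    {s : Set α} (hs : MeasurableSet s) (f : Lp ℂ 2 μ) :
    ENNReal.ofReal (‖indicatorOp μ s hs f‖ ^ 2) = ∫⁻ x in s, ‖f x‖ₑ ^ 2 ∂μ := by
  rw [ofReal_norm_sq_eq_lintegral, ← lintegral_indicator hs]
  apply lintegral_congr_ae
  filter_upwards [coeFn_indicatorOp μ s hs f] with x hx
  rw [hx]
  by_cases h : x ∈ s <;> simp [h]

/-- Tonelli: for fixed x the centres z with |u(x) − z| ≤ r fill a ball of radius r, whose volume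
does not depend on x. -/
theorem lintegral_norm_indicatorOp_closedBall_sq {α : Type*} [MeasurableSpace α] {μ : Measure α}
    [SFinite μ] {u : α → E3} (hu : Measurable u) (η : Lp ℂ 2 μ) (r : ℝ) :
    ∫⁻ z, ENNReal.ofReal (‖indicatorOp μ (u ⁻¹' Metric.closedBall z r)
      (hu Metric.isClosed_closedBall.measurableSet) η‖ ^ 2) =
      volume (Metric.closedBall (0 : E3) r) * ENNReal.ofReal (‖η‖ ^ 2) := by
  set k : E3 → ℝ≥0∞ := (Metric.closedBall (0 : E3) r).indicator 1 with hk
  have hkm : Measurable k := measurable_one.indicator Metric.isClosed_closedBall.measurableSet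
  have h1 : ∀ z, ENNReal.ofReal (‖indicatorOp μ (u ⁻¹' Metric.closedBall z r)
      (hu Metric.isClosed_closedBall.measurableSet) η‖ ^ 2) =
      ∫⁻ x, k (u x - z) * ‖η x‖ₑ ^ 2 ∂μ := fun z => by
    rw [ofReal_norm_indicatorOp_sq_eq_lintegral,
      ← lintegral_indicator (hu Metric.isClosed_closedBall.measurableSet)]
    refine lintegral_congr fun x => ?_
    have hiff : x ∈ u ⁻¹' Metric.closedBall z r ↔ u x - z ∈ Metric.closedBall (0 : E3) r := by
      rw [Set.mem_preimage, mem_closedBall_iff_norm, mem_closedBall_zero_iff]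
    by_cases h : u x - z ∈ Metric.closedBall (0 : E3) r
    · rw [Set.indicator_of_mem (hiff.2 h), hk, Set.indicator_of_mem h, Pi.one_apply, one_mul]
    · rw [Set.indicator_of_notMem (fun h' => h (hiff.1 h')), hk, Set.indicator_of_notMem h,
        zero_mul]
  simp only [h1]
  rw [lintegral_lintegral_swap, ofReal_norm_sq_eq_lintegral, ← lintegral_const_mul'']
  · refine lintegral_congr fun x => ?_
    rw [lintegral_mul_const _ (by fun_prop), lintegral_sub_left_eq_self k (u x), hk,
      lintegral_indicator_one Metric.isClosed_closedBall.measurableSet]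
  · exact (Lp.memLp η).1.enorm.pow_const 2
  · refine AEMeasurable.mul ?_ ((Lp.memLp η).1.enorm.pow_const 2).comp_snd
    exact (hkm.comp ((hu.comp measurable_snd).sub measurable_fst)).aemeasurable

theorem lintegral_norm_ballAt_sq {N : ℕ} (j : Fin N) (r : ℝ) (Φ : NBody N) :
    ∫⁻ z, ENNReal.ofReal (‖ballAt j r z Φ‖ ^ 2) =
      volume (Metric.closedBall (0 : E3) r) * ENNReal.ofReal (‖Φ‖ ^ 2) :=
  lintegral_norm_indicatorOp_closedBall_sq (measurable_pi_apply j) Φ r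

theorem lintegral_norm_ballOp_sq (r : ℝ) (u : OneBody) :
    ∫⁻ z, ENNReal.ofReal (‖ballOp r z u‖ ^ 2) =
      volume (Metric.closedBall (0 : E3) r) * ENNReal.ofReal (‖u‖ ^ 2) :=
  lintegral_norm_indicatorOp_closedBall_sq measurable_id u r

theorem lintegral_sum_norm_ballAt_sq {N : ℕ} (r : ℝ) (Φ : Fin N → NBody N) :
    ∫⁻ z, ENNReal.ofReal (∑ j, ‖ballAt j r z (Φ j)‖ ^ 2) =
      volume (Metric.closedBall (0 : E3) r) * ENNReal.ofReal (∑ j, ‖Φ j‖ ^ 2) := by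
  simp only [ENNReal.ofReal_sum_of_nonneg fun _ _ => sq_nonneg (_ : ℝ)]
  rw [lintegral_finsetSum, Finset.mul_sum]
  · exact Finset.sum_congr rfl fun j _ => lintegral_norm_ballAt_sq j r _
  · intro j _
    have := ((continuous_ballAt j (Φ j)).comp (Continuous.prodMk_right r)).norm.pow 2
    exact (ENNReal.continuous_ofReal.comp this).measurable

theorem lintegral_ballTrace {N : ℕ} {φ : Fin N → OneBody} (hφ : Orthonormal ℂ φ) (r : ℝ) :
    ∫⁻ z, ENNReal.ofReal (ballTrace φ r z) = volume (Metric.closedBall (0 : E3) r) * N := by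
  simp only [ballTrace, ENNReal.ofReal_sum_of_nonneg fun _ _ => sq_nonneg (_ : ℝ)]
  rw [lintegral_finsetSum]
  · simp only [lintegral_norm_ballOp_sq, hφ.1]
    simp [mul_comm]
  · intro j _
    have := ((continuous_ballOp (φ j)).comp (Continuous.prodMk_right r)).norm.pow 2
    exact (ENNReal.continuous_ofReal.comp this).measurable

/-- Averaging D over centres gives |B_r|(N − dΓ(p)) = |B_r| dΓ(q). Subtraction in `ℝ≥0∞` is
truncated, so the identity is proved with the dΓ(pXp) term added to both sides; that term is finite
and is cancelled at the end. -/
theorem IsFermionic.lintegral_holeBall {N : ℕ} {φ : Fin N → OneBody} (hφ : Orthonormal ℂ φ)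
    {χ : NBody N} (hχ : IsFermionic χ) (r : ℝ) :
    ∫⁻ z, ENNReal.ofReal (holeBall φ r z χ) =
      volume (Metric.closedBall (0 : E3) r) * ENNReal.ofReal (∑ j, ‖coprojAt φ j χ‖ ^ 2) := by
  set V := volume (Metric.closedBall (0 : E3) r) with hV
  have hVfin : V ≠ ⊤ := measure_closedBall_lt_top.ne
  have h1 : (∫⁻ z, ENNReal.ofReal (holeBall φ r z χ)) +
      ∫⁻ z, ENNReal.ofReal (∑ j, ‖ballAt j r z (projAt φ j χ)‖ ^ 2) =
      V * N * ENNReal.ofReal (‖χ‖ ^ 2) := by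
    have hm : Measurable fun z => ENNReal.ofReal (holeBall φ r z χ) :=
      (ENNReal.continuous_ofReal.comp
        ((continuous_holeBall φ χ).comp (Continuous.prodMk_right r))).measurable
    have hm2 : Measurable fun z => ENNReal.ofReal (ballTrace φ r z) :=
      (ENNReal.continuous_ofReal.comp
        ((continuous_ballTrace φ).comp (Continuous.prodMk_right r))).measurable
    rw [← lintegral_add_left hm, ← lintegral_ballTrace hφ, ← lintegral_mul_const _ hm2]
    refine lintegral_congr fun z => ?_
    rw [← ENNReal.ofReal_add (hχ.holeBall_nonneg hφ r z)
      (Finset.sum_nonneg fun _ _ => by positivity),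
      ← ENNReal.ofReal_mul (ballTrace_nonneg φ r z), holeBall, sub_add_cancel]
  have h2 : (N : ℝ≥0∞) * ENNReal.ofReal (‖χ‖ ^ 2) =
      ENNReal.ofReal (∑ j, ‖coprojAt φ j χ‖ ^ 2) + ENNReal.ofReal (∑ j, ‖projAt φ j χ‖ ^ 2) := by
    rw [← ENNReal.ofReal_add (Finset.sum_nonneg fun _ _ => by positivity)
      (Finset.sum_nonneg fun _ _ => by positivity), ← Finset.sum_add_distrib,
      ← ENNReal.ofReal_natCast, ← ENNReal.ofReal_mul (Nat.cast_nonneg _)]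
    congr 1
    simp only [add_comm (‖coprojAt φ _ χ‖ ^ 2), norm_projAt_sq_add_norm_coprojAt_sq hφ]
    simp
  rw [lintegral_sum_norm_ballAt_sq, mul_assoc, h2, mul_add] at h1
  exact (ENNReal.add_left_inj (ENNReal.mul_ne_top hVfin ENNReal.ofReal_ne_top)).1 h1

/-! ### Bounds on `Tr[X p]` -/

theorem ballTrace_le {N : ℕ} {φ : Fin N → OneBody} (hφ : Orthonormal ℂ φ) (r : ℝ) (z : E3) :
    ballTrace φ r z ≤ N := by
  have h : ∀ i, ‖ballOp r z (φ i)‖ ^ 2 ≤ 1 := fun i => by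
    have := norm_indicatorLin_le volume (Metric.closedBall z r)
      Metric.isClosed_closedBall.measurableSet (φ i)
    rw [hφ.1 i, mul_one] at this
    exact pow_le_one₀ (norm_nonneg _) this
  exact (Finset.sum_le_sum fun i _ => h i).trans (by simp)

theorem aestronglyMeasurable_hfDensity {N : ℕ} (φ : Fin N → OneBody) :
    AEStronglyMeasurable (hfDensity φ) volume :=
  Finset.aestronglyMeasurable_fun_sum _ fun i _ => (Lp.memLp (φ i)).1.norm.pow 2

theorem ofReal_ballTrace_eq {N : ℕ} (φ : Fin N → OneBody) (r : ℝ) (z : E3) :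
    ENNReal.ofReal (ballTrace φ r z) =
      eLpNorm (hfDensity φ) 1 (volume.restrict (Metric.closedBall z r)) := by
  rw [eLpNorm_one_eq_lintegral_enorm, ballTrace,
    ENNReal.ofReal_sum_of_nonneg fun _ _ => sq_nonneg (_ : ℝ)]
  have h : ∀ i, ENNReal.ofReal (‖ballOp r z (φ i)‖ ^ 2) =
      ∫⁻ x in Metric.closedBall z r, ‖φ i x‖ₑ ^ 2 := fun i =>
    ofReal_norm_indicatorOp_sq_eq_lintegral _ (φ i)
  simp only [h]
  rw [← lintegral_finsetSum' _ fun i _ => ((Lp.memLp (φ i)).1.enorm.pow_const 2).restrict]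
  refine lintegral_congr fun x => ?_
  rw [hfDensity, Real.enorm_of_nonneg (Finset.sum_nonneg fun _ _ => by positivity),
    ENNReal.ofReal_sum_of_nonneg fun _ _ => sq_nonneg (_ : ℝ)]
  simp only [ENNReal.ofReal_pow (norm_nonneg _), ofReal_norm]

/-- Tr[Xp] is the integral of f_HF over the ball; Hölder with exponents 5/3 and 5/2 gives the power
2/5 of the volume. -/
theorem ofReal_ballTrace_le {N : ℕ} (φ : Fin N → OneBody) (r : ℝ) (z : E3) :
    ENNReal.ofReal (ballTrace φ r z) ≤ eLpNorm (hfDensity φ) (5 / 3) volume *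
      volume (Metric.closedBall z r) ^ (2 / 5 : ℝ) := by
  have h53 : (1 : ℝ≥0∞) ≤ 5 / 3 := by
    rw [ENNReal.le_div_iff_mul_le (by simp) (by simp)]
    norm_num
  have h := eLpNorm_le_eLpNorm_mul_rpow_measure_univ (μ := volume.restrict (Metric.closedBall z r))
    h53 (aestronglyMeasurable_hfDensity φ).restrict
  rw [ofReal_ballTrace_eq]
  refine h.trans ?_
  rw [Measure.restrict_apply_univ]
  have e : 1 / (1 : ℝ≥0∞).toReal - 1 / (5 / 3 : ℝ≥0∞).toReal = 2 / 5 := by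
    rw [ENNReal.toReal_div]
    norm_num
  rw [e]
  gcongr
  exact Measure.restrict_le_self

/-! ### The integrated bound -/

theorem volume_closedBall_eq (z : E3) (r : ℝ) :
    volume (Metric.closedBall z r) = ENNReal.ofReal r ^ 3 * ENNReal.ofReal (Real.pi * 4 / 3) :=
  EuclideanSpace.volume_closedBall_fin_three z r

theorem IsFermionic.abs_cancellationIntegrand_le {N : ℕ} {φ : Fin N → OneBody}
    (hφ : Orthonormal ℂ φ) {Ψ : NBody N} (hΨ : IsFermionic Ψ) (g : ℝ → ℝ) (ω : ℝ × E3) :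
    |cancellationIntegrand φ g Ψ ω| ≤ ballTrace φ ω.1 ω.2 *
      (evaporatedBall φ ω.1 ω.2 (hat φ (fun y => Real.sqrt (g y - shiftBy 1 g y)) Ψ) +
        holeBall φ ω.1 ω.2 (hat φ (fun y => Real.sqrt (shiftBy (-1) g y - g y)) Ψ)) := by
  rw [cancellationIntegrand_eq, abs_neg, abs_mul, abs_two]
  refine le_trans ?_ ((hΨ.hat_apply φ _).norm_inner_dGamma_holeOp_le hφ _ ω.1 ω.2)
  gcongr
  exact Complex.abs_im_le_norm _

/-- The factor 2 counts the two contributions, from Φ and from χ, each bounded by |B_r| S_g. -/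
theorem IsFermionic.lintegral_cancellationIntegrand_le {N : ℕ} (hN : 1 ≤ N) (θ : ℝ)
    {φ : Fin N → OneBody} (hφ : Orthonormal ℂ φ) {Ψ : NBody N} (hΨ : IsFermionic Ψ) (r : ℝ)
    {K : ℝ≥0∞} (hK : ∀ z, ENNReal.ofReal (ballTrace φ r z) ≤ K) :
    ∫⁻ z, ‖cancellationIntegrand φ (gTheta N θ) Ψ (r, z)‖ₑ ≤
      K * volume (Metric.closedBall (0 : E3) r) *
        (2 * ENNReal.ofReal (evaporation φ (gTheta N θ) Ψ)) := by
  set Φ := hat φ (fun y => Real.sqrt (gTheta N θ y - shiftBy 1 (gTheta N θ) y)) Ψ with hΦ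
  set χ := hat φ (fun y => Real.sqrt (shiftBy (-1) (gTheta N θ) y - gTheta N θ y)) Ψ with hχ
  have hχf : IsFermionic χ := hΨ.hat_apply φ _
  have hm1 : Measurable fun z => ENNReal.ofReal (evaporatedBall φ r z Φ) :=
    (ENNReal.continuous_ofReal.comp
      ((continuous_evaporatedBall φ Φ).comp (Continuous.prodMk_right r))).measurable
  have hm2 : Measurable fun z => ENNReal.ofReal (holeBall φ r z χ) :=
    (ENNReal.continuous_ofReal.comp
      ((continuous_holeBall φ χ).comp (Continuous.prodMk_right r))).measurable
  calc ∫⁻ z, ‖cancellationIntegrand φ (gTheta N θ) Ψ (r, z)‖ₑ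
      ≤ ∫⁻ z, K * (ENNReal.ofReal (evaporatedBall φ r z Φ) +
          ENNReal.ofReal (holeBall φ r z χ)) := by
        refine lintegral_mono fun z => ?_
        rw [Real.enorm_eq_ofReal_abs]
        refine (ENNReal.ofReal_le_ofReal
          (hΨ.abs_cancellationIntegrand_le hφ (gTheta N θ) (r, z))).trans ?_
        rw [ENNReal.ofReal_mul (ballTrace_nonneg φ _ _),
          ENNReal.ofReal_add (evaporatedBall_nonneg φ _ _ _) (hχf.holeBall_nonneg hφ _ _)]
        exact mul_le_mul_left (hK z) _
    _ = K * (volume (Metric.closedBall (0 : E3) r) *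
          ENNReal.ofReal (∑ j, ‖coprojAt φ j Φ‖ ^ 2) + volume (Metric.closedBall (0 : E3) r) *
          ENNReal.ofReal (∑ j, ‖coprojAt φ j χ‖ ^ 2)) := by
        rw [lintegral_const_mul K (show Measurable fun z => ENNReal.ofReal (evaporatedBall φ r z Φ) +
          ENNReal.ofReal (holeBall φ r z χ) from hm1.add hm2), lintegral_add_left hm1,
          hχf.lintegral_holeBall hφ]
        simp only [evaporatedBall]
        rw [lintegral_sum_norm_ballAt_sq]
    _ ≤ K * (volume (Metric.closedBall (0 : E3) r) *
          ENNReal.ofReal (evaporation φ (gTheta N θ) Ψ) + volume (Metric.closedBall (0 : E3) r) *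
          ENNReal.ofReal (evaporation φ (gTheta N θ) Ψ)) := by
        gcongr
        · exact sum_norm_coprojAt_hat_gTheta_sub_sq_le hN θ hφ Ψ
        · exact sum_norm_coprojAt_hat_sub_gTheta_sq_le hN θ hφ Ψ
    _ = _ := by ring

/-- No finiteness of the density norm is assumed, so the bound also serves the case of infinite norm
and vanishing S_g. -/
theorem IsFermionic.lintegral_feffermanMeasure_le {N : ℕ} (hN : 1 ≤ N) (θ : ℝ)
    {φ : Fin N → OneBody} (hφ : Orthonormal ℂ φ) {Ψ : NBody N} (hΨ : IsFermionic Ψ) :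
    ∫⁻ ω, ‖cancellationIntegrand φ (gTheta N θ) Ψ ω‖ₑ ∂feffermanMeasure ≤
      (∫⁻ r in Set.Ioi (0 : ℝ), ENNReal.ofReal (1 / (Real.pi * r ^ 5)) *
        (min (eLpNorm (hfDensity φ) (5 / 3) volume *
          volume (Metric.closedBall (0 : E3) r) ^ (2 / 5 : ℝ)) N *
            volume (Metric.closedBall (0 : E3) r))) *
        (2 * ENNReal.ofReal (evaporation φ (gTheta N θ) Ψ)) := by
  have hc := continuous_cancellationIntegrand φ (gTheta N θ) Ψ
  have hd : Measurable fun r : ℝ => ENNReal.ofReal (1 / (Real.pi * r ^ 5)) := by fun_prop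
  have hV : Measurable fun r : ℝ => volume (Metric.closedBall (0 : E3) r) := by
    simp only [volume_closedBall_eq]
    fun_prop
  have hG : Measurable fun r : ℝ => min (eLpNorm (hfDensity φ) (5 / 3) volume *
      volume (Metric.closedBall (0 : E3) r) ^ (2 / 5 : ℝ)) N *
        volume (Metric.closedBall (0 : E3) r) :=
    (((hV.pow_const _).const_mul _).min measurable_const).mul hV
  rw [feffermanMeasure, lintegral_prod _ hc.enorm.measurable.aemeasurable]
  have h1 : ∀ r : ℝ, ∫⁻ z, ‖cancellationIntegrand φ (gTheta N θ) Ψ (r, z)‖ₑ ≤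
      (min (eLpNorm (hfDensity φ) (5 / 3) volume *
        volume (Metric.closedBall (0 : E3) r) ^ (2 / 5 : ℝ)) N *
          volume (Metric.closedBall (0 : E3) r)) *
        (2 * ENNReal.ofReal (evaporation φ (gTheta N θ) Ψ)) := fun r =>
    hΨ.lintegral_cancellationIntegrand_le hN θ hφ r fun z => by
      refine le_min ((ofReal_ballTrace_le φ r z).trans_eq ?_) ?_
      · rw [volume_closedBall_eq, volume_closedBall_eq]
      · rw [← ENNReal.ofReal_natCast]
        exact ENNReal.ofReal_le_ofReal (ballTrace_le hφ r z)
  refine (lintegral_mono h1).trans_eq ?_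
  rw [lintegral_mul_const _ hG, lintegral_withDensity_eq_lintegral_mul _ hd hG]
  rfl

/-! ### The radial integral and the constants -/

theorem lintegral_Ioc_ofReal_rpow {A R : ℝ} (hA : 0 ≤ A) (hR : 0 ≤ R) :
    ∫⁻ r in Set.Ioc 0 R, ENNReal.ofReal (A * r ^ (-(4 / 5) : ℝ)) =
      ENNReal.ofReal (A * (5 * R ^ (1 / 5 : ℝ))) := by
  have hi : IntervalIntegrable (fun r : ℝ => r ^ (-(4 / 5) : ℝ)) volume 0 R :=
    intervalIntegral.intervalIntegrable_rpow' (by norm_num)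
  have hi' := (intervalIntegrable_iff_integrableOn_Ioc_of_le hR).1 hi
  rw [← ofReal_integral_eq_lintegral_ofReal (hi'.const_mul A), integral_const_mul,
    ← intervalIntegral.integral_of_le hR, integral_rpow (Or.inl (by norm_num))]
  · congr 2
    rw [Real.zero_rpow (by norm_num)]
    norm_num
    ring
  · filter_upwards [ae_restrict_mem measurableSet_Ioc] with r hr
    exact mul_nonneg hA (Real.rpow_nonneg hr.1.le _)

theorem lintegral_Ioi_ofReal_rpow {A R : ℝ} (hA : 0 ≤ A) (hR : 0 < R) :
    ∫⁻ r in Set.Ioi R, ENNReal.ofReal (A * r ^ (-2 : ℝ)) = ENNReal.ofReal (A * R⁻¹) := by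
  have hi := integrableOn_Ioi_rpow_of_lt (a := -2) (by norm_num) hR
  rw [← ofReal_integral_eq_lintegral_ofReal (hi.const_mul A), integral_const_mul,
    integral_Ioi_rpow_of_lt (by norm_num) hR]
  · congr 2
    norm_num
    rw [Real.rpow_neg_one]
  · filter_upwards [ae_restrict_mem measurableSet_Ioi] with r hr
    exact mul_nonneg hA (Real.rpow_nonneg (hR.trans hr).le _)

theorem mul_div_rpow_one_sixth {n P : ℝ} (hn : 0 < n) (hP : 0 < P) :
    P * ((n / P) ^ (5 / 6 : ℝ)) ^ (1 / 5 : ℝ) = n ^ (1 / 6 : ℝ) * P ^ (5 / 6 : ℝ) := by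
  have h : P = P ^ (5 / 6 : ℝ) * P ^ (1 / 6 : ℝ) := by
    rw [← Real.rpow_add hP]
    norm_num
  rw [← Real.rpow_mul (by positivity), Real.div_rpow hn.le hP.le]
  norm_num
  nth_rewrite 1 [h]
  field_simp

theorem mul_div_rpow_inv {n P : ℝ} (hn : 0 < n) (hP : 0 < P) :
    n * ((n / P) ^ (5 / 6 : ℝ))⁻¹ = n ^ (1 / 6 : ℝ) * P ^ (5 / 6 : ℝ) := by
  have h : n = n ^ (5 / 6 : ℝ) * n ^ (1 / 6 : ℝ) := by
    rw [← Real.rpow_add hn]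
    norm_num
  rw [Real.div_rpow hn.le hP.le]
  nth_rewrite 1 [h]
  field_simp

theorem lintegral_radial_le {F n : ℝ} (hF : 0 < F) (hn : 0 < n) :
    ∫⁻ r in Set.Ioi (0 : ℝ), ENNReal.ofReal (1 / (Real.pi * r ^ 5)) *
        (min (ENNReal.ofReal F * volume (Metric.closedBall (0 : E3) r) ^ (2 / 5 : ℝ))
          (ENNReal.ofReal n) * volume (Metric.closedBall (0 : E3) r)) ≤
      ENNReal.ofReal (8 * (Real.pi * 4 / 3) ^ (1 / 3 : ℝ) * n ^ (1 / 6 : ℝ) *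
        F ^ (5 / 6 : ℝ)) := by
  set κ : ℝ := Real.pi * 4 / 3 with hκ
  have hκ0 : 0 < κ := by positivity
  set P : ℝ := F * κ ^ (2 / 5 : ℝ) with hP
  have hP0 : 0 < P := by positivity
  -- R is the radius where the two bounds agree: P R^{6/5} = n. Below it the integrand is at most a
  -- multiple of r^{−5}r^{6/5}r³ = r^{−4/5}, above it a multiple of r^{−5}r³ = r^{−2}.
  set R : ℝ := (n / P) ^ (5 / 6 : ℝ) with hR
  have hR0 : 0 < R := by positivity
  have hV : ∀ r : ℝ, 0 < r → volume (Metric.closedBall (0 : E3) r) = ENNReal.ofReal (r ^ 3 * κ) :=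
    fun r hr => by
      rw [volume_closedBall_eq, ← ENNReal.ofReal_pow hr.le, ENNReal.ofReal_mul (by positivity)]
  rw [← Set.Ioc_union_Ioi_eq_Ioi hR0.le]
  refine (lintegral_union_le _ _ _).trans ?_
  have h1 : ∫⁻ r in Set.Ioc 0 R, ENNReal.ofReal (1 / (Real.pi * r ^ 5)) *
        (min (ENNReal.ofReal F * volume (Metric.closedBall (0 : E3) r) ^ (2 / 5 : ℝ))
          (ENNReal.ofReal n) * volume (Metric.closedBall (0 : E3) r)) ≤
      ∫⁻ r in Set.Ioc 0 R, ENNReal.ofReal (4 / 3 * P * r ^ (-(4 / 5) : ℝ)) := by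
    refine setLIntegral_mono' measurableSet_Ioc fun r hr => ?_
    have hr0 : 0 < r := hr.1
    refine (mul_le_mul_right (mul_le_mul_left (min_le_left _ _) _) _).trans_eq ?_
    rw [hV r hr0, ENNReal.ofReal_rpow_of_nonneg (by positivity) (by positivity),
      ← ENNReal.ofReal_mul (by positivity), ← ENNReal.ofReal_mul (by positivity),
      ← ENNReal.ofReal_mul (by positivity)]
    congr 1
    have e : (r ^ 3) ^ (2 / 5 : ℝ) = r ^ (-(4 / 5) : ℝ) * r ^ 2 := by
      rw [← Real.rpow_natCast r 3, ← Real.rpow_natCast r 2, ← Real.rpow_mul hr0.le,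
        ← Real.rpow_add hr0]
      norm_num
    rw [Real.mul_rpow (by positivity) hκ0.le, e, hP]
    -- Only the κ of the volume is unfolded: it cancels the π of the measure and leaves 4/3, while
    -- κ^{2/5} stays inside P.
    nth_rewrite 2 [hκ]
    field_simp
  have h2 : ∫⁻ r in Set.Ioi R, ENNReal.ofReal (1 / (Real.pi * r ^ 5)) *
        (min (ENNReal.ofReal F * volume (Metric.closedBall (0 : E3) r) ^ (2 / 5 : ℝ))
          (ENNReal.ofReal n) * volume (Metric.closedBall (0 : E3) r)) ≤
      ∫⁻ r in Set.Ioi R, ENNReal.ofReal (4 / 3 * n * r ^ (-2 : ℝ)) := by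
    refine setLIntegral_mono' measurableSet_Ioi fun r hr => ?_
    have hr0 : 0 < r := hR0.trans hr
    refine (mul_le_mul_right (mul_le_mul_left (min_le_right _ _) _) _).trans_eq ?_
    rw [hV r hr0, ← ENNReal.ofReal_mul (by positivity), ← ENNReal.ofReal_mul (by positivity)]
    congr 1
    have e : r ^ (-2 : ℝ) = (r ^ 2)⁻¹ := by
      rw [Real.rpow_neg hr0.le]
      norm_num
    rw [e, hκ]
    field_simp
  refine (add_le_add h1 h2).trans_eq ?_
  rw [lintegral_Ioc_ofReal_rpow (by positivity) hR0.le,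
    lintegral_Ioi_ofReal_rpow (by positivity) hR0, ← ENNReal.ofReal_add (by positivity)
    (by positivity)]
  congr 1
  have e1 := mul_div_rpow_one_sixth hn hP0
  have e2 := mul_div_rpow_inv hn hP0
  rw [← hR] at e1 e2
  have e3 : P ^ (5 / 6 : ℝ) = F ^ (5 / 6 : ℝ) * κ ^ (1 / 3 : ℝ) := by
    rw [hP, Real.mul_rpow hF.le (by positivity), ← Real.rpow_mul hκ0.le]
    norm_num
  -- The inner region contributes 20/3 and the outer one 4/3 of the same quantity n^{1/6}P^{5/6},
  -- hence the 8.
  calc 4 / 3 * P * (5 * R ^ (1 / 5 : ℝ)) + 4 / 3 * n * R⁻¹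
      = 20 / 3 * (P * R ^ (1 / 5 : ℝ)) + 4 / 3 * (n * R⁻¹) := by ring
    _ = 8 * (n ^ (1 / 6 : ℝ) * P ^ (5 / 6 : ℝ)) := by rw [e1, e2]; ring
    _ = _ := by rw [e3]; ring

/-- The slack is enough for (4/3)^{1/3} ≤ 9/8 and 5^{−5/6} ≥ 1/4, the latter from 5⁵ = 3125 ≤ 4⁶;
then 16 · 9/8 = 18 = 72/4. -/
theorem sixteen_mul_rpow_le :
    16 * (Real.pi * 4 / 3) ^ (1 / 3 : ℝ) ≤
      (5 : ℝ) ^ (-(5 / 6) : ℝ) * 72 * Real.pi ^ (1 / 3 : ℝ) := by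
  have h1 : (4 / 3 : ℝ) ^ (1 / 3 : ℝ) ≤ 9 / 8 := by
    rw [← Real.le_rpow_inv_iff_of_pos (by norm_num) (by norm_num) (by norm_num)]
    norm_num
  have h2 : (1 / 4 : ℝ) ≤ (5 : ℝ) ^ (-(5 / 6) : ℝ) := by
    have h : (5 : ℝ) ^ (5 / 6 : ℝ) ≤ 4 := by
      have : (5 : ℝ) ^ (5 / 6 : ℝ) = (3125 : ℝ) ^ (1 / 6 : ℝ) := by
        rw [show (3125 : ℝ) = 5 ^ (5 : ℝ) by norm_num, ← Real.rpow_mul (by norm_num)]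
        norm_num
      rw [this, ← Real.le_rpow_inv_iff_of_pos (by norm_num) (by norm_num) (by norm_num)]
      norm_num
    rw [Real.rpow_neg (by norm_num), one_div]
    gcongr
  rw [mul_div_assoc, Real.mul_rpow Real.pi_pos.le (by norm_num)]
  have hpi : 0 ≤ Real.pi ^ (1 / 3 : ℝ) := by positivity
  calc 16 * (Real.pi ^ (1 / 3 : ℝ) * (4 / 3 : ℝ) ^ (1 / 3 : ℝ))
      ≤ 16 * (Real.pi ^ (1 / 3 : ℝ) * (9 / 8)) := by gcongr
    _ = 1 / 4 * 72 * Real.pi ^ (1 / 3 : ℝ) := by ring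
    _ ≤ _ := by gcongr

/-- A zero norm would make Tr[Xp] vanish for every ball of radius 1, yet its integral over centres
is N|B_1| > 0. Positivity is needed to define the splitting radius. -/
theorem eLpNorm_hfDensity_ne_zero {N : ℕ} (hN : 1 ≤ N) {φ : Fin N → OneBody}
    (hφ : Orthonormal ℂ φ) : eLpNorm (hfDensity φ) (5 / 3) volume ≠ 0 := fun h => by
  have h1 := lintegral_ballTrace hφ 1
  have h2 : ∀ z, ENNReal.ofReal (ballTrace φ 1 z) = 0 := fun z => by
    have := ofReal_ballTrace_le φ 1 z
    rwa [h, zero_mul, nonpos_iff_eq_zero] at this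
  simp only [h2, lintegral_zero] at h1
  rcases mul_eq_zero.1 h1.symm with h3 | h3
  · exact (Metric.measure_closedBall_pos volume (0 : E3) one_pos).ne' h3
  · exact absurd (Nat.cast_eq_zero.1 h3) (by omega)

theorem IsFermionic.lintegral_feffermanMeasure_le_of_ne_top {N : ℕ} (hN : 1 ≤ N) (θ : ℝ)
    {φ : Fin N → OneBody} (hφ : Orthonormal ℂ φ) {Ψ : NBody N} (hΨ : IsFermionic Ψ)
    (hF : eLpNorm (hfDensity φ) (5 / 3) volume ≠ ⊤) :
    ∫⁻ ω, ‖cancellationIntegrand φ (gTheta N θ) Ψ ω‖ₑ ∂feffermanMeasure ≤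
      ENNReal.ofReal ((5 : ℝ) ^ (-(5 / 6) : ℝ) * 72 * Real.pi ^ (1 / 3 : ℝ) *
          (N : ℝ) ^ (1 / 6 : ℝ)) *
        eLpNorm (hfDensity φ) (5 / 3) volume ^ (5 / 6 : ℝ) *
        ENNReal.ofReal (evaporation φ (gTheta N θ) Ψ) := by
  have hN0 : (0 : ℝ) < N := by exact_mod_cast hN
  set F := (eLpNorm (hfDensity φ) (5 / 3) volume).toReal with hFdef
  have hF0 : 0 < F := ENNReal.toReal_pos (eLpNorm_hfDensity_ne_zero hN hφ) hF
  have hFe : eLpNorm (hfDensity φ) (5 / 3) volume = ENNReal.ofReal F :=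
    (ENNReal.ofReal_toReal hF).symm
  refine (hΨ.lintegral_feffermanMeasure_le hN θ hφ).trans ?_
  rw [hFe, ← ENNReal.ofReal_natCast, ← mul_assoc]
  refine mul_le_mul_left ?_ _
  refine (mul_le_mul_left (lintegral_radial_le hF0 hN0) _).trans ?_
  rw [ENNReal.ofReal_rpow_of_pos hF0, ← ENNReal.ofReal_ofNat 2,
    ← ENNReal.ofReal_mul (by positivity), ← ENNReal.ofReal_mul (by positivity)]
  refine ENNReal.ofReal_le_ofReal ?_
  calc _ = 16 * (Real.pi * 4 / 3) ^ (1 / 3 : ℝ) * (N : ℝ) ^ (1 / 6 : ℝ) * F ^ (5 / 6 : ℝ) := by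
        ring
    _ ≤ _ := by
        refine mul_le_mul_of_nonneg_right (mul_le_mul_of_nonneg_right sixteen_mul_rpow_le ?_) ?_ <;>
          positivity

end

theorem mainTheorem5 (N : ℕ) (hN : 1 ≤ N) (θ : ℝ) (hθ : 0 < θ)
    (φ : Fin N → OneBody) (hφ : Orthonormal ℂ φ)
    (Ψ : NBody N) (hΨ : IsFermionic Ψ) (hΨ1 : ‖Ψ‖ = 1) :
    (eLpNorm (hfDensity φ) (5 / 3) volume < ⊤ →
      Integrable (cancellationIntegrand φ (gTheta N θ) Ψ) feffermanMeasure) ∧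
    ENNReal.ofReal |cancellationTerm φ (gTheta N θ) Ψ| ≤
      ENNReal.ofReal ((5 : ℝ) ^ (-(5 / 6) : ℝ) * 72 * Real.pi ^ (1 / 3 : ℝ) *
          (N : ℝ) ^ (1 / 6 : ℝ)) *
        eLpNorm (hfDensity φ) (5 / 3) volume ^ (5 / 6 : ℝ) *
        ENNReal.ofReal (evaporation φ (gTheta N θ) Ψ) := by
  refine ⟨fun hF => ⟨(continuous_cancellationIntegrand φ _ Ψ).aestronglyMeasurable, ?_⟩, ?_⟩
  · refine (hΨ.lintegral_feffermanMeasure_le_of_ne_top hN θ hφ hF.ne).trans_lt ?_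
    exact ENNReal.mul_lt_top (ENNReal.mul_lt_top ENNReal.ofReal_lt_top
      (ENNReal.rpow_lt_top_of_nonneg (by norm_num) hF.ne)) ENNReal.ofReal_lt_top
  · rw [← Real.enorm_eq_ofReal_abs, cancellationTerm]
    -- This holds without integrability, since the Bochner integral is then 0 by convention.
    refine (enorm_integral_le_lintegral_enorm _).trans ?_
    by_cases hF : eLpNorm (hfDensity φ) (5 / 3) volume = ⊤
    -- With infinite norm the right-hand side is ∞ unless S_g = 0. In that case it is 0 by the
    -- convention ∞ · 0 = 0, and the bound before the radial integration is already 0.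
    · by_cases hS : ENNReal.ofReal (evaporation φ (gTheta N θ) Ψ) = 0
      · refine (hΨ.lintegral_feffermanMeasure_le hN θ hφ).trans ?_
        rw [hS, mul_zero, mul_zero, mul_zero]
      · rw [hF, ENNReal.top_rpow_of_pos (by norm_num), ENNReal.mul_top, ENNReal.top_mul hS]
        · exact le_top
        · exact (ENNReal.ofReal_pos.2 (by positivity)).ne'
    · exact hΨ.lintegral_feffermanMeasure_le_of_ne_top hN θ hφ hF
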